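/- **Setting.** Let $(X,d)$ be a metric space with a Borel measure $\mu$ such that $0<\mu(B(x,r))<\infty$ for all $x\in X$, $r\in(0,\infty)$. A variable exponent is a measurable $q:X\to(0,\infty]$ with $q^-:=\operatorname{ess\,inf}q>0$; $q\in\mathcal P(X)$. $\mathcal P_b^{\log}(X)$ is the set of exponents $p$ with $p^+:=\operatorname{ess\,sup}p<\infty$ for which $1/p$ is log-Hölder: $|1/p(x)-1/p(y)|\le C/\log(e+1/d(x,y))$ for all $x\ne y$, for some $C>0$ (such $p$ are finite everywhere). Write $\gamma\gg p$ if $\operatorname{ess\,inf}(\gamma-p)>0$. For $E\subseteq X$ measurable, $\|f\|_{L^{p(\cdot)}(E)}:=\inf\{t\in(0,\infty):\int_E|f/t|^{p(x)}\,d\mu\le1\}$ (with $\inf\emptyset=\infty$). For $s\in\mathcal P_b^{\log}(X)$ a sequence $g=(g_k)_{k\in\mathbb Z}$ of measurable functions $g_k\ge 0$ is a vector $s(\cdot)$-gradient of a measurable function $u$ on $E$ if, off a null set, $|u(x)-u(y)|\le d(x,y)^{s(x)}g_k(x)+d(x,y)^{s(y)}g_k(y)$ for all $k\in\mathbb Z$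 and all $x,y\in E$ with $2^{-k-1}\le d(x,y)<2^{-k}$. Let $\|u\|_{\dot M^{s(\cdot)}_{p(\cdot),q(\cdot)}(E)}$ and $\|u\|_{\dot N^{s(\cdot)}_{p(\cdot),q(\cdot)}(E)}$ be the infimum over all such $g$ of, respectively, $\big\|\,\|(g_k)_k\|_{\ell^{q(\cdot)}}\big\|_{L^{p(\cdot)}(E)}$ and $$\|g\|_{\ell^{q(\cdot)}(L^{p(\cdot)}(E))}:=\inf\Big\{\lambda\in(0,\infty):\sum_{k\in\mathbb Z}\inf\big\{t\in(0,\infty):\int_E\big(\tfrac{g_k}{\lambda t^{1/q(x)}}\big)^{p(x)}d\mu\le1\big\}\le1\Big\},\qquad t^{1/\infty}:=1 .$$ For $A\in\{M,N\}$, $\dot A^{s(\cdot)}_{p(\cdot),q(\cdot)}(E)$ consists of the measurable $u$ (identified a.e.) with finite $\dot A$-quasi-norm, and $\|u\|_{A^{s(\cdot)}_{p(\cdot),q(\cdot)}(X)}:=\|u\|_{L^{p(\cdot)}(X)}+\|u\|_{\dot A^{s(\cdot)}_{p(\cdot),q(\cdot)}(X)}$ is the inhomogeneous quasi-norm. The measure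 $\mu$ is *lower Ahlfors $Q(\cdot)$-regular* if there is $b>0$ with $\mu(B(x,r))\ge b\,r^{Q(x)}$ for all $x\in X$, $r\in(0,1]$. The space $X$ is *uniformly perfect* if there is $\lambda\in(0,1)$ such that $B(x,r)\setminus B(x,\lambda r)\ne\emptyset$ whenever $x\in X$, $r>0$ and $X\setminus B(x,r)\neq\emptyset$. **Theorem.** Let $A\in\{M,N\}$, $\sigma\in[1,\infty)$, $p,s\in\mathcal P_b^{\log}(X)$ and $q\in\mathcal P(X)$, and assume that $s^+\le1$, with $s^+=1$ allowed only if $q^-=\infty$. (i) Let $\gamma\in\mathcal P_b^{\log}(X)$, $\gamma\gg p$, and suppose that there is a constant $C>0$ such that one of the following holds: (a) $\|u\|_{L^{\gamma(\cdot)}(X)}\le C\|u\|_{\dot A^{s(\cdot)}_{p(\cdot),q(\cdot)}(X)}$ for all $u\in\dot A^{s(\cdot)}_{p(\cdot),q(\cdot)}(X)$; (b) $\inf_{c\in\mathbb R}\|u-c\|_{L^{\gamma(\cdot)}(X)}\le C\|u\|_{\dot A^{s(\cdot)}_{p(\cdot),q(\cdot)}(X)}$ for all $u\in\dot A^{s(\cdot)}_{p(\cdot),q(\cdot)}(X)$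 (the embedding modulo constants); (c) $\|u\|_{L^{\gamma(\cdot)}(X)}\le C\|u\|_{A^{s(\cdot)}_{p(\cdot),q(\cdot)}(X)}$ for all $u\in A^{s(\cdot)}_{p(\cdot),q(\cdot)}(X)$ (the inhomogeneous embedding). Then $\mu$ is lower Ahlfors $Q(\cdot)$-regular with $Q=\frac{\gamma sp}{\gamma-p}$. Assume in addition that $X$ is uniformly perfect. Then: (ii) Let $\gamma\in\mathcal P_b^{\log}(X)$, $\gamma\gg p$, $Q:=\frac{sp\gamma}{\gamma-p}$, and suppose there are $C_S,\omega>0$ such that for all $x_0\in X$, $0<r_0\le1/\sigma$, with $B_0=B(x_0,r_0)$, $\sigma B_0=B(x_0,\sigma r_0)$, and all $u\in\dot A^{s(\cdot)}_{p(\cdot),q(\cdot)}(\sigma B_0)$, $$\inf_{c\in\mathbb R}\|u-c\|_{L^{\gamma(\cdot)}(B_0)}\le C_S\Big(\frac{\mu(B_0)}{r_0^{Q(x_0)}}\Big)^{\omega}\|u\|_{\dot A^{s(\cdot)}_{p(\cdot),q(\cdot)}(\sigma B_0)} .$$ Then $\mu$ is lower Ahlfors $Q(\cdot)$-regular. (iii)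 Suppose there are $C_1,C_2,\omega>0$ such that for all $x_0\in X$, $0<r_0\le1/\sigma$, with $B_0$ and $\sigma B_0$ as in (ii), and all $u\in\dot A^{s(\cdot)}_{p(\cdot),q(\cdot)}(\sigma B_0)$ with $\|u\|_{\dot A^{s(\cdot)}_{p(\cdot),q(\cdot)}(\sigma B_0)}>0$, $$\inf_{c\in\mathbb R}\frac1{\mu(B_0)}\int_{B_0}\exp\bigg[\Big(C_1\frac{|u(x)-c|}{\|u\|_{\dot A^{s(\cdot)}_{p(\cdot),q(\cdot)}(\sigma B_0)}}\Big)^{\omega}\bigg]d\mu(x)\le C_2 .$$ Then $\mu$ is lower Ahlfors $Q(\cdot)$-regular with $Q=sp$. (iv) Suppose that $X$ has at least two points, $\alpha\in\mathcal P_b^{\log}(X)$, and there is $C>0$ such that every $u\in\dot A^{s(\cdot)}_{p(\cdot),q(\cdot)}(X)$ has a continuous representative $v$ with $\sup_{x\ne y}\frac{|v(x)-v(y)|}{d(x,y)^{\alpha(x)}}\le C\|u\|_{\dot A^{s(\cdot)}_{p(\cdot),q(\cdot)}(X)}$ (that is, $\dot A^{s(\cdot)}_{p(\cdot),q(\cdot)}(X)\hookrightarrow\dot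 C^{0,\alpha(\cdot)}(X)$). Then $s\ge\alpha$ everywhere on $X$, $\mu$ is lower Ahlfors $Q(\cdot)$-regular with $Q=p(s-\alpha)$, and $\mu(\{x_0\})>0$ for every $x_0\in X$ with $s(x_0)=\alpha(x_0)$. -/

import Mathlib

open MeasureTheory Set
open scoped ENNReal

/-! ### Metric measure spaces -/

/-- The standing assumption on the Borel measure of a metric measure space:
every ball of positive finite radius has positive and finite measure. -/
def IsMetricMeasure {X : Type*} [MetricSpace X] [MeasurableSpace X] (μ : Measure X) : Prop :=
  ∀ (x : X) (r : ℝ), 0 < r → 0 < μ (Metric.ball x r) ∧ μ (Metric.ball x r) < ∞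

/-- Lower Ahlfors `Q(·)`-regularity: `μ (B(x,r)) ≥ b r ^ Q(x)` for all `x` and `r ∈ (0,1]`. -/
def LowerAhlforsRegular {X : Type*} [MetricSpace X] [MeasurableSpace X] (μ : Measure X)
    (Q : X → ℝ) : Prop :=
  ∃ b : ℝ, 0 < b ∧ ∀ (x : X) (r : ℝ), 0 < r → r ≤ 1 →
    ENNReal.ofReal (b * r ^ Q x) ≤ μ (Metric.ball x r)

/-- Uniform perfectness of a metric space. -/
def UniformlyPerfect (X : Type*) [MetricSpace X] : Prop :=
  ∃ l : ℝ, 0 < l ∧ l < 1 ∧ ∀ (x : X) (r : ℝ), 0 < r →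
    ((Metric.ball x r)ᶜ).Nonempty → (Metric.ball x r \ Metric.ball x (l * r)).Nonempty

/-! ### Variable exponents -/

/-- The class of all variable exponents `q : X → (0,∞]`: measurable with `q⁻ > 0`. -/
def IsExponent {X : Type*} [MeasurableSpace X] (μ : Measure X) (q : X → ℝ≥0∞) : Prop :=
  Measurable q ∧ (∀ x, 0 < q x) ∧ 0 < essInf q μ

/-- Essentially bounded (real-valued) variable exponents: `0 < p⁻` and `p⁺ < ∞`. -/
def IsBddExponent {X : Type*} [MeasurableSpace X] (μ : Measure X) (p : X → ℝ) : Prop :=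
  Measurable p ∧ (∀ x, 0 < p x) ∧
    (∃ m : ℝ, 0 < m ∧ ∀ᵐ x ∂μ, m ≤ p x) ∧ (∃ M : ℝ, ∀ᵐ x ∂μ, p x ≤ M)

/-- Local log-Hölder continuity of a function on the whole space. -/
def LogHolder {X : Type*} [MetricSpace X] (f : X → ℝ) : Prop :=
  ∃ C : ℝ, 0 < C ∧ ∀ x y : X, x ≠ y →
    |f x - f y| ≤ C / Real.log (Real.exp 1 + 1 / dist x y)

/-- Bounded variable exponents `p` for which `1/p` is locally log-Hölder continuous.
(Since `1/p` is then continuous and balls have positive measure, such a `p` is real-valued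
and bounded everywhere, so nothing is lost by taking values in `ℝ` from the start.) -/
def IsBddLogExponent {X : Type*} [MetricSpace X] [MeasurableSpace X] (μ : Measure X)
    (p : X → ℝ) : Prop :=
  IsBddExponent μ p ∧ LogHolder (fun x => 1 / p x)

/-- `p ≫ q`, that is, `(p - q)⁻ > 0`. -/
def ExponentGG {X : Type*} [MeasurableSpace X] (μ : Measure X) (p q : X → ℝ) : Prop :=
  ∃ ε : ℝ, 0 < ε ∧ ∀ᵐ x ∂μ, ε ≤ p x - q x

/-- `s⁺ ≼_{q⁻} 1`: `s⁺ ≤ 1`, and the value `s⁺ = 1` is permitted only if `q⁻ = ∞`. -/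
def SmoothnessAdmissible {X : Type*} [MeasurableSpace X] (μ : Measure X)
    (s : X → ℝ) (q : X → ℝ≥0∞) : Prop :=
  essSup (fun x => ENNReal.ofReal (s x)) μ ≤ 1 ∧
    (essSup (fun x => ENNReal.ofReal (s x)) μ = 1 → essInf q μ = ∞)

/-! ### Variable exponent Lebesgue and mixed Lebesgue sequence spaces

All quasi-norms are `[0,∞]`-valued; the corresponding space consists of the measurable
functions (or sequences) whose quasi-norm is finite. -/

/-- The semi-modular `∫ f(x) ^ p(x) dν(x)` of a nonnegative function. -/
noncomputable def lebesgueModular {X : Type*} [MeasurableSpace X] (ν : Measure X) (p : X → ℝ)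
    (f : X → ℝ≥0∞) : ℝ≥0∞ :=
  ∫⁻ x, f x ^ p x ∂ν

/-- The Luxemburg quasi-norm of `L^{p(·)}(ν)` of a nonnegative function. -/
noncomputable def lebesgueNorm {X : Type*} [MeasurableSpace X] (ν : Measure X) (p : X → ℝ)
    (f : X → ℝ≥0∞) : ℝ≥0∞ :=
  sInf {t : ℝ≥0∞ | 0 < t ∧ t < ∞ ∧ lebesgueModular ν p (fun x => f x / t) ≤ 1}

/-- The pointwise `ℓ^{q}`-quasi-norm of a nonnegative two-sided sequence, `0 < q ≤ ∞`. -/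
noncomputable def seqNorm (q : ℝ≥0∞) (a : ℤ → ℝ≥0∞) : ℝ≥0∞ :=
  if q = ∞ then ⨆ k, a k else (∑' k, a k ^ q.toReal) ^ (1 / q.toReal)

/-- The quasi-norm of `L^{p(·)}(ℓ^{q(·)})`. -/
noncomputable def lebesgueSeqNorm {X : Type*} [MeasurableSpace X] (ν : Measure X) (p : X → ℝ)
    (q : X → ℝ≥0∞) (g : ℤ → X → ℝ≥0∞) : ℝ≥0∞ :=
  lebesgueNorm ν p (fun x => seqNorm (q x) (fun k => g k x))

/-- The semi-modular of `ℓ^{q(·)}(L^{p(·)})`; for `q x = ∞` the exponent `(q x)⁻¹.toReal` is `0`,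
in accordance with the convention `t ^ (1/∞) = 1`. -/
noncomputable def seqLebesgueModular {X : Type*} [MeasurableSpace X] (ν : Measure X) (p : X → ℝ)
    (q : X → ℝ≥0∞) (g : ℤ → X → ℝ≥0∞) : ℝ≥0∞ :=
  ∑' k, sInf {t : ℝ≥0∞ | 0 < t ∧ t < ∞ ∧
    lebesgueModular ν p (fun x => g k x / t ^ ((q x)⁻¹).toReal) ≤ 1}

/-- The quasi-norm of `ℓ^{q(·)}(L^{p(·)})`. -/
noncomputable def seqLebesgueNorm {X : Type*} [MeasurableSpace X] (ν : Measure X) (p : X → ℝ)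
    (q : X → ℝ≥0∞) (g : ℤ → X → ℝ≥0∞) : ℝ≥0∞ :=
  sInf {t : ℝ≥0∞ | 0 < t ∧ t < ∞ ∧ seqLebesgueModular ν p q (fun k x => g k x / t) ≤ 1}

/-! ### Hajłasz–Triebel–Lizorkin and Hajłasz–Besov spaces

Functions are identified when they agree almost everywhere, so that it is enough to consider
real-valued representatives. For a measurable set `E`, functions on the metric measure space
`(E, d, μ)` are represented by functions on `X`, of which only the values on `E` are used. -/

/-- `g = (g_k)` is a vector `s(·)`-gradient of `u` on the measurable set `E`. -/
def IsVectorGradient {X : Type*} [MetricSpace X] [MeasurableSpace X] (μ : Measure X)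
    (s : X → ℝ) (E : Set X) (u : X → ℝ) (g : ℤ → X → ℝ≥0∞) : Prop :=
  (∀ k, Measurable (g k)) ∧
    ∃ N : Set X, μ N = 0 ∧ ∀ k : ℤ, ∀ x ∈ E \ N, ∀ y ∈ E \ N,
      (2 : ℝ) ^ (-k - 1) ≤ dist x y → dist x y < (2 : ℝ) ^ (-k) →
        ENNReal.ofReal |u x - u y| ≤
          ENNReal.ofReal (dist x y ^ s x) * g k x + ENNReal.ofReal (dist x y ^ s y) * g k y

/-- The two scales of spaces: `M` (Hajłasz–Triebel–Lizorkin) and `N` (Hajłasz–Besov). -/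
inductive HajlaszScale where
  | M
  | N

/-- The sequence quasi-norm underlying each of the two scales:
`L^{p(·)}(ℓ^{q(·)})` for `M` and `ℓ^{q(·)}(L^{p(·)})` for `N`. -/
noncomputable def gradientNorm {X : Type*} [MeasurableSpace X] (A : HajlaszScale)
    (ν : Measure X) (p : X → ℝ) (q : X → ℝ≥0∞) (g : ℤ → X → ℝ≥0∞) : ℝ≥0∞ :=
  match A with
  | .M => lebesgueSeqNorm ν p q g
  | .N => seqLebesgueNorm ν p q g

/-- The homogeneous quasi-(semi)norm of `u` in `Ȧ^{s(·)}_{p(·),q(·)}(E, d, μ)`. -/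
noncomputable def homNorm {X : Type*} [MetricSpace X] [MeasurableSpace X] (A : HajlaszScale)
    (μ : Measure X) (s p : X → ℝ) (q : X → ℝ≥0∞) (E : Set X) (u : X → ℝ) : ℝ≥0∞ :=
  ⨅ (g : ℤ → X → ℝ≥0∞) (_ : IsVectorGradient μ s E u g), gradientNorm A (μ.restrict E) p q g

/-- Membership in the homogeneous space `Ȧ^{s(·)}_{p(·),q(·)}(E, d, μ)`. -/
def MemHom {X : Type*} [MetricSpace X] [MeasurableSpace X] (A : HajlaszScale)
    (μ : Measure X) (s p : X → ℝ) (q : X → ℝ≥0∞) (E : Set X) (u : X → ℝ) : Prop :=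
  Measurable u ∧ homNorm A μ s p q E u < ∞

/-- The quasi-norm of `u` in the inhomogeneous space `A^{s(·)}_{p(·),q(·)}(X, d, μ)`. -/
noncomputable def inhomNorm {X : Type*} [MetricSpace X] [MeasurableSpace X] (A : HajlaszScale)
    (μ : Measure X) (s p : X → ℝ) (q : X → ℝ≥0∞) (u : X → ℝ) : ℝ≥0∞ :=
  lebesgueNorm μ p (fun x => ENNReal.ofReal |u x|) + homNorm A μ s p q univ u

/-! ### Exponential averages -/

/-- The integral average over `B` of `exp (f(x) ^ ω)`. -/
noncomputable def expAverage {X : Type*} [MeasurableSpace X] (μ : Measure X) (B : Set X)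
    (ω : ℝ) (f : X → ℝ) : ℝ≥0∞ :=
  (∫⁻ x in B, ENNReal.ofReal (Real.exp (f x ^ ω)) ∂μ) / μ B

/-! ### Global embeddings -/

/-- `Ȧ^{s(·)}_{p(·),q(·)}(X) ↪ L^{γ(·)}(X)`, read literally. -/
def HomEmbedsLebesgue {X : Type*} [MetricSpace X] [MeasurableSpace X] (A : HajlaszScale)
    (μ : Measure X) (s p : X → ℝ) (q : X → ℝ≥0∞) (γ : X → ℝ) : Prop :=
  ∃ C : ℝ, 0 < C ∧ ∀ u : X → ℝ, MemHom A μ s p q univ u →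
    lebesgueNorm μ γ (fun x => ENNReal.ofReal |u x|) ≤
      ENNReal.ofReal C * homNorm A μ s p q univ u

/-- `Ȧ^{s(·)}_{p(·),q(·)}(X) ↪ L^{γ(·)}(X)` modulo additive constants. -/
def HomEmbedsLebesgueModConst {X : Type*} [MetricSpace X] [MeasurableSpace X] (A : HajlaszScale)
    (μ : Measure X) (s p : X → ℝ) (q : X → ℝ≥0∞) (γ : X → ℝ) : Prop :=
  ∃ C : ℝ, 0 < C ∧ ∀ u : X → ℝ, MemHom A μ s p q univ u →
    (⨅ c : ℝ, lebesgueNorm μ γ (fun x => ENNReal.ofReal |u x - c|)) ≤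
      ENNReal.ofReal C * homNorm A μ s p q univ u

/-- `A^{s(·)}_{p(·),q(·)}(X) ↪ L^{γ(·)}(X)` for the inhomogeneous space. -/
def InhomEmbedsLebesgue {X : Type*} [MetricSpace X] [MeasurableSpace X] (A : HajlaszScale)
    (μ : Measure X) (s p : X → ℝ) (q : X → ℝ≥0∞) (γ : X → ℝ) : Prop :=
  ∃ C : ℝ, 0 < C ∧ ∀ u : X → ℝ, Measurable u → inhomNorm A μ s p q u < ∞ →
    lebesgueNorm μ γ (fun x => ENNReal.ofReal |u x|) ≤
      ENNReal.ofReal C * inhomNorm A μ s p q u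

/-- The variable exponent Hölder seminorm `sup_{x ≠ y} |v(x) - v(y)| / d(x,y) ^ α(x)`. -/
noncomputable def holderSeminorm {X : Type*} [MetricSpace X] (α : X → ℝ) (v : X → ℝ) : ℝ≥0∞ :=
  ⨆ (x : X) (y : X) (_ : x ≠ y), ENNReal.ofReal (|v x - v y| / dist x y ^ α x)

/-- `Ȧ^{s(·)}_{p(·),q(·)}(X) ↪ Ċ^{0,α(·)}(X)`: every `u` in the former space has a continuous
representative in the latter one, with control of the seminorm. -/
def HomEmbedsHolder {X : Type*} [MetricSpace X] [MeasurableSpace X] (A : HajlaszScale)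
    (μ : Measure X) (s p : X → ℝ) (q : X → ℝ≥0∞) (α : X → ℝ) : Prop :=
  ∃ C : ℝ, 0 < C ∧ ∀ u : X → ℝ, MemHom A μ s p q univ u →
    ∃ v : X → ℝ, Continuous v ∧ v =ᵐ[μ] u ∧
      holderSeminorm α v ≤ ENNReal.ofReal C * homNorm A μ s p q univ u

/-! ### Estimates for the Lebesgue and mixed quasi-norms -/

section Norms

variable {X : Type*} [MeasurableSpace X] {ν : Measure X} {p : X → ℝ} {q : X → ℝ≥0∞}

/-! Every embedding is tested on radial bumps `radialBump z a b`, equal to 1 on the closed ball of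
radius a and to 0 off the ball of radius b. With L = b - a, the k-th entry of a vector gradient has
size min(1/(2^k L), 1) (2^k L)^s L^{-s} on the ball. If s stays away from 0 and 1, this decays
geometrically in k on both sides of 2^k ≈ 1/L, so the sum over k costs only a constant for any q
with q⁻ > 0. If s⁺ = 1 the entries are merely bounded, and q = ∞ is what is needed. Either way the
quasi-norm of the bump is at most a constant times the L^p norm of L^{-s} on the ball
(`exists_homNorm_radialBump_le`), roughly L^{-s} μ(B(z,b))^{1/p}.

In the Sobolev cases the embedding bounds this from below by roughly the measure of the inner ball
to the power 1/γ. If the inner ball carries at least half the measure of the outer one, then L^s ≲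
μ(B(z,b))^{1/p-1/γ}. No doubling is available to compare balls of comparable radii, so radii are
chosen by halving the measure: each gap between consecutive radii is bounded by a power of the
measure, the gaps form a geometric series, and they exhaust the full radius
(`radius_rpow_le_of_gap`). This gives r^s ≲ μ(B)^{1/p-1/γ}, the assertion with Q = s/(1/p-1/γ).

Variable exponents are frozen at the centre of the ball, at the price of an oscillation d.
Log-Hölder continuity bounds d log(1/r). The estimate itself bounds log(1/μ(B)) by a constant plus a
multiple of log(1/r), so d log(1/μ(B)) is bounded too and all errors become constants
(`absorb_log_error`).

In the local cases uniform perfectness provides two disjoint balls inside B(x,r). The bump lives in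
the one of smaller measure and vanishes on the other, so no constant approximates it on both. In
(ii) the extra factor (μ(B)/r^Q)^ω only helps when μ(B) < r^Q, the only case of interest. In (iii)
the exponential bound gives a logarithm, which is traded for a small power so that the same
iteration applies. For (iv) a single bump with a = 0 is compared at its centre with a nearby point
outside its support. -/

theorem lebesgueModular_mono_ae (hp : ∀ x, 0 < p x) {f g : X → ℝ≥0∞} (h : ∀ᵐ x ∂ν, f x ≤ g x) :
    lebesgueModular ν p f ≤ lebesgueModular ν p g := by
  refine lintegral_mono_ae ?_
  filter_upwards [h] with x hx
  exact ENNReal.rpow_le_rpow hx (hp x).le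

theorem lebesgueNorm_le {f : X → ℝ≥0∞} {t : ℝ≥0∞} (h0 : 0 < t) (h1 : t < ∞)
    (h : lebesgueModular ν p (fun x => f x / t) ≤ 1) : lebesgueNorm ν p f ≤ t :=
  sInf_le ⟨h0, h1, h⟩

/-- Lower bound for the quasi-norm of a function which is large on a set of known measure. -/
theorem mul_rpow_le_lebesgueNorm {F : Set X} (hF : MeasurableSet F)
    {f : X → ℝ≥0∞} {η m G : ℝ} (hη : 0 < η) (hm : 0 < m) (hG : 0 < G)
    (hp : ∀ x ∈ F, 0 < p x) (hpG : ∀ x ∈ F, 1 / p x ≤ G)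
    (hf : ∀ x ∈ F, ENNReal.ofReal η ≤ f x) (hmF : ENNReal.ofReal m ≤ ν F) (hm1 : m ≤ 1) :
    ENNReal.ofReal (η * m ^ G) ≤ lebesgueNorm ν p f := by
  refine le_sInf ?_
  rintro t ⟨ht0, ht, hmod⟩
  by_contra! hlt
  obtain ⟨τ, rfl⟩ : ∃ τ : ℝ, t = ENNReal.ofReal τ := ⟨t.toReal, (ENNReal.ofReal_toReal ht.ne).symm⟩
  have hτ : 0 < τ := ENNReal.ofReal_pos.mp ht0
  have hlt' : τ < η * m ^ G := (ENNReal.ofReal_lt_ofReal_iff (by positivity)).mp hlt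
  have hmG : m ^ G ≤ 1 := Real.rpow_le_one hm.le hm1 hG.le
  have h1 : m ^ (-G) < η / τ := by
    rw [Real.rpow_neg hm.le, lt_div_iff₀ hτ, inv_mul_lt_iff₀ (by positivity)]
    linarith
  -- Since `m ≤ 1`, the base η/τ is at least 1, so replacing the exponent p(x) by its lower bound
  -- 1/G only decreases the power. Already (η/τ)^{1/G} exceeds 1/m, which makes the modular over F
  -- larger than 1.
  have h2 : 1 ≤ η / τ := by
    refine le_trans ?_ h1.le
    exact Real.one_le_rpow_of_pos_of_le_one_of_nonpos hm hm1 (by linarith)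
  have h3 : m⁻¹ < (η / τ) ^ (1 / G) := by
    calc m⁻¹ = (m ^ (-G)) ^ (1 / G) := by
          rw [← Real.rpow_mul hm.le, show -G * (1 / G) = -1 by field_simp, Real.rpow_neg_one]
      _ < _ := Real.rpow_lt_rpow (by positivity) h1 (by positivity)
  have h4 : ∀ x ∈ F, ENNReal.ofReal ((η / τ) ^ (1 / G)) ≤
      (f x / ENNReal.ofReal τ) ^ p x := by
    intro x hx
    have hpx := hp x hx
    calc ENNReal.ofReal ((η / τ) ^ (1 / G)) ≤ ENNReal.ofReal ((η / τ) ^ p x) := by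
          refine ENNReal.ofReal_le_ofReal (Real.rpow_le_rpow_of_exponent_le h2 ?_)
          have := hpG x hx
          rw [div_le_iff₀ hpx] at this
          rw [div_le_iff₀ hG]; linarith
      _ = (ENNReal.ofReal η / ENNReal.ofReal τ) ^ p x := by
          rw [← ENNReal.ofReal_div_of_pos hτ, ENNReal.ofReal_rpow_of_pos (by positivity)]
      _ ≤ _ := by
          refine ENNReal.rpow_le_rpow ?_ hpx.le
          gcongr
          exact hf x hx
  have h5 : ENNReal.ofReal ((η / τ) ^ (1 / G)) * ENNReal.ofReal m ≤ 1 := by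
    calc ENNReal.ofReal ((η / τ) ^ (1 / G)) * ENNReal.ofReal m
        ≤ ENNReal.ofReal ((η / τ) ^ (1 / G)) * ν F := by gcongr
      _ = ∫⁻ _ in F, ENNReal.ofReal ((η / τ) ^ (1 / G)) ∂ν := by simp
      _ ≤ ∫⁻ x in F, (f x / ENNReal.ofReal τ) ^ p x ∂ν := setLIntegral_mono' hF h4
      _ ≤ _ := setLIntegral_le_lintegral _ _
      _ ≤ 1 := hmod
  rw [← ENNReal.ofReal_mul (by positivity), ENNReal.ofReal_le_one] at h5
  rw [inv_lt_iff_one_lt_mul₀ hm] at h3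
  linarith

/-- A sequence dominated by `c k * h x` with `c` small in `ℓ^{q₀}`, `q₀ ≤ q⁻`, is controlled
by `h` on both scales. -/
theorem gradientNorm_le_of_tsum_le (A : HajlaszScale) (hp : ∀ x, 0 < p x) {q₀ : ℝ} (hq₀ : 0 < q₀)
    (hq : ∀ᵐ x ∂ν, ENNReal.ofReal q₀ ≤ q x) {g : ℤ → X → ℝ≥0∞} {c : ℤ → ℝ≥0∞} {h : X → ℝ≥0∞}
    (hc0 : ∀ k, 0 < c k) (hc : ∑' k, c k ^ q₀ ≤ 1)
    (hg : ∀ᵐ x ∂ν, ∀ k, g k x ≤ c k * h x) {T : ℝ≥0∞} (hT0 : 0 < T) (hT : T < ∞)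
    (hmod : lebesgueModular ν p (fun x => h x / T) ≤ 1) :
    gradientNorm A ν p q g ≤ T := by
  have hck : ∀ k, c k ≤ 1 := by
    intro k
    have h1 : c k ^ q₀ ≤ 1 := (ENNReal.le_tsum k).trans hc
    by_contra! h2
    exact absurd h1 (not_le.mpr (ENNReal.one_lt_rpow h2 hq₀))
  cases A with
  | M =>
    refine lebesgueNorm_le hT0 hT (le_trans (lebesgueModular_mono_ae hp ?_) hmod)
    filter_upwards [hq, hg] with x hqx hgx
    gcongr
    unfold seqNorm
    split_ifs with hinf
    · refine iSup_le fun k => (hgx k).trans ?_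
      exact mul_le_of_le_one_left zero_le (hck k)
    · have hq0 : q₀ ≤ (q x).toReal := (ENNReal.ofReal_le_iff_le_toReal hinf).mp hqx
      have hqpos : 0 < (q x).toReal := hq₀.trans_le hq0
      have h1 : ∑' k, g k x ^ (q x).toReal ≤ h x ^ (q x).toReal := by
        calc ∑' k, g k x ^ (q x).toReal ≤ ∑' k, c k ^ q₀ * h x ^ (q x).toReal := by
              refine ENNReal.tsum_le_tsum fun k => ?_
              calc g k x ^ (q x).toReal ≤ (c k * h x) ^ (q x).toReal :=
                    ENNReal.rpow_le_rpow (hgx k) hqpos.le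
                _ = c k ^ (q x).toReal * h x ^ (q x).toReal :=
                    ENNReal.mul_rpow_of_nonneg _ _ hqpos.le
                _ ≤ _ := by
                    exact mul_le_mul' (ENNReal.rpow_le_rpow_of_exponent_ge (hck k) hq0) le_rfl
          _ = (∑' k, c k ^ q₀) * h x ^ (q x).toReal := ENNReal.tsum_mul_right
          _ ≤ 1 * h x ^ (q x).toReal := by gcongr
          _ = _ := one_mul _
      calc (∑' k, g k x ^ (q x).toReal) ^ (1 / (q x).toReal)
          ≤ (h x ^ (q x).toReal) ^ (1 / (q x).toReal) := ENNReal.rpow_le_rpow h1 (by positivity)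
        _ = h x := by
          rw [← ENNReal.rpow_mul, mul_one_div_cancel hqpos.ne', ENNReal.rpow_one]
  | N =>
    refine sInf_le ⟨hT0, hT, le_trans (ENNReal.tsum_le_tsum fun k => ?_) hc⟩
    have hcq1 : c k ^ q₀ ≤ 1 := ENNReal.rpow_le_one (hck k) hq₀.le
    have hcfin : c k ≠ ∞ := ((hck k).trans_lt ENNReal.one_lt_top).ne
    -- The witness for the k-th infimum is t = c_k^{q₀}: these sum to at most 1, and t^{1/q(x)} ≥
    -- c_k because c_k ≤ 1 and q₀/q(x) ≤ 1. Positivity of c_k makes t admissible.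
    refine sInf_le ⟨ENNReal.rpow_pos (hc0 k) hcfin, hcq1.trans_lt ENNReal.one_lt_top, ?_⟩
    refine le_trans (lebesgueModular_mono_ae hp ?_) hmod
    filter_upwards [hq, hg] with x hqx hgx
    have hcle : c k ≤ (c k ^ q₀) ^ ((q x)⁻¹).toReal := by
      rw [← ENNReal.rpow_mul]
      conv_lhs => rw [← ENNReal.rpow_one (c k)]
      refine ENNReal.rpow_le_rpow_of_exponent_ge (hck k) ?_
      have h1 : ((q x)⁻¹).toReal ≤ (ENNReal.ofReal q₀)⁻¹.toReal := by
        refine ENNReal.toReal_mono ?_ (ENNReal.inv_le_inv.mpr hqx)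
        simpa using hq₀
      rw [ENNReal.toReal_inv (ENNReal.ofReal q₀), ENNReal.toReal_ofReal hq₀.le] at h1
      calc q₀ * ((q x)⁻¹).toReal ≤ q₀ * q₀⁻¹ := by gcongr
        _ = 1 := mul_inv_cancel₀ hq₀.ne'
    calc g k x / T / (c k ^ q₀) ^ ((q x)⁻¹).toReal ≤ c k * h x / T / c k := by
          gcongr; exact hgx k
      _ = h x / T := by
          rw [mul_div_assoc, mul_comm, ENNReal.mul_div_cancel_right (hc0 k).ne' hcfin]

/-- The case `q = ∞` of the preceding bound. -/
theorem gradientNorm_le_of_le_of_eq_top (A : HajlaszScale) (hp : ∀ x, 0 < p x)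
    (hq : ∀ᵐ x ∂ν, q x = ∞) {g : ℤ → X → ℝ≥0∞} {h : X → ℝ≥0∞}
    (hg : ∀ᵐ x ∂ν, ∀ k, g k x ≤ h x) {T : ℝ≥0∞} (hT0 : 0 < T) (hT : T < ∞)
    (hmod : lebesgueModular ν p (fun x => h x / T) ≤ 1) :
    gradientNorm A ν p q g ≤ T := by
  cases A with
  | M =>
    refine lebesgueNorm_le hT0 hT (le_trans (lebesgueModular_mono_ae hp ?_) hmod)
    filter_upwards [hq, hg] with x hqx hgx
    gcongr
    simp only [seqNorm, hqx, if_true]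
    exact iSup_le hgx
  | N =>
    refine sInf_le ⟨hT0, hT, ?_⟩
    -- As t^{1/∞} = 1, the inner condition does not depend on t. Every t > 0 is admissible and each
    -- infimum is 0.
    have h0 : seqLebesgueModular ν p q (fun k x => g k x / T) = 0 := by
      refine ENNReal.tsum_eq_zero.mpr fun k => le_antisymm ?_ zero_le
      refine ENNReal.le_of_forall_pos_le_add fun ε hε _ => ?_
      rw [zero_add]
      refine sInf_le ⟨by simpa using hε, ENNReal.coe_lt_top, ?_⟩
      refine le_trans (lebesgueModular_mono_ae hp ?_) hmod
      filter_upwards [hq, hg] with x hqx hgx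
      simp only [hqx, ENNReal.inv_top, ENNReal.toReal_zero, ENNReal.rpow_zero, div_one]
      gcongr
      exact hgx k
    rw [h0]; exact zero_le

/-- Each entry of a sequence is controlled by the mixed quasi-norm. -/
theorem lebesgueModular_div_le_one_of_gradientNorm_lt (A : HajlaszScale) (hp : ∀ x, 0 < p x)
    {q₀ : ℝ} (hq₀ : 0 < q₀) (hq : ∀ᵐ x ∂ν, ENNReal.ofReal q₀ ≤ q x) {g : ℤ → X → ℝ≥0∞}
    {ε : ℝ≥0∞} (hg : gradientNorm A ν p q g < ε) (k : ℤ) :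
    lebesgueModular ν p (fun x => g k x / (ε * 2 ^ q₀⁻¹)) ≤ 1 := by
  have h2 : (1 : ℝ≥0∞) ≤ 2 ^ q₀⁻¹ := ENNReal.one_le_rpow one_le_two (by positivity)
  cases A with
  | M =>
    obtain ⟨t, ⟨ht0, ht, hmod⟩, htε⟩ := sInf_lt_iff.mp hg
    refine le_trans (lebesgueModular_mono_ae hp ?_) hmod
    filter_upwards [hq] with x hqx
    have h1 : g k x ≤ seqNorm (q x) (fun k => g k x) := by
      unfold seqNorm
      split_ifs with hinf
      · exact le_iSup (fun k => g k x) k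
      · have hq0 : q₀ ≤ (q x).toReal := (ENNReal.ofReal_le_iff_le_toReal hinf).mp hqx
        have hqpos : 0 < (q x).toReal := hq₀.trans_le hq0
        calc g k x = (g k x ^ (q x).toReal) ^ (1 / (q x).toReal) := by
              rw [← ENNReal.rpow_mul, mul_one_div_cancel hqpos.ne', ENNReal.rpow_one]
          _ ≤ _ := ENNReal.rpow_le_rpow (ENNReal.le_tsum k) (by positivity)
    refine ENNReal.div_le_div h1 (htε.le.trans ?_)
    exact le_mul_of_one_le_right zero_le h2
  | N =>
    obtain ⟨t, ⟨ht0, ht, hmod⟩, htε⟩ := sInf_lt_iff.mp hg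
    -- The infimum is at most 1 but need not be attained. Relaxing to `< 2` yields an actual τ, at
    -- the cost of the factor τ^{1/q(x)} ≤ 2^{1/q₀}.
    have h1 : sInf {τ : ℝ≥0∞ | 0 < τ ∧ τ < ∞ ∧
        lebesgueModular ν p (fun x => g k x / t / τ ^ ((q x)⁻¹).toReal) ≤ 1} < 2 :=
      ((ENNReal.le_tsum k).trans hmod).trans_lt ENNReal.one_lt_two
    obtain ⟨τ, ⟨hτ0, hτ, hmod'⟩, hτ2⟩ := sInf_lt_iff.mp h1
    refine le_trans (lebesgueModular_mono_ae hp ?_) hmod'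
    filter_upwards [hq] with x hqx
    rw [div_eq_mul_inv (g k x / t), div_eq_mul_inv (g k x) t, mul_assoc,
      ← ENNReal.mul_inv (Or.inl ht0.ne') (Or.inl ht.ne), ← div_eq_mul_inv]
    refine ENNReal.div_le_div le_rfl (mul_le_mul' htε.le ?_)
    have h3 : ((q x)⁻¹).toReal ≤ q₀⁻¹ := by
      have h1 : ((q x)⁻¹).toReal ≤ (ENNReal.ofReal q₀)⁻¹.toReal := by
        refine ENNReal.toReal_mono ?_ (ENNReal.inv_le_inv.mpr hqx)
        simpa using hq₀
      rwa [ENNReal.toReal_inv (ENNReal.ofReal q₀), ENNReal.toReal_ofReal hq₀.le] at h1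
    calc τ ^ ((q x)⁻¹).toReal ≤ 2 ^ ((q x)⁻¹).toReal :=
          ENNReal.rpow_le_rpow hτ2.le ENNReal.toReal_nonneg
      _ ≤ 2 ^ q₀⁻¹ := ENNReal.rpow_le_rpow_of_exponent_le one_le_two h3

theorem lebesgueModular_smul_indicator_div {ν : Measure X} (hp : ∀ x, 0 < p x) {B : Set X}
    (hB : MeasurableSet B) {f : X → ℝ} {c T : ℝ} (hc : 0 < c) (hT : 0 < T) :
    lebesgueModular ν p (fun x => B.indicator (fun y => ENNReal.ofReal (c * f y)) x /
      ENNReal.ofReal (c * T)) = ∫⁻ y in B, ENNReal.ofReal (f y / T) ^ p y ∂ν := by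
  rw [← lintegral_indicator hB]
  refine lintegral_congr fun y => ?_
  beta_reduce
  by_cases hy : y ∈ B
  · rw [indicator_of_mem hy, indicator_of_mem hy, ← ENNReal.ofReal_div_of_pos (by positivity),
      mul_div_mul_left _ _ hc.ne']
  · rw [indicator_of_notMem hy, indicator_of_notMem hy, ENNReal.zero_div,
      ENNReal.zero_rpow_of_pos (hp y)]

end Norms

/-! ### Bump functions and their gradients -/

section Bump

variable {X : Type*} [MetricSpace X]

/-- The function equal to `1` on the closed ball of radius `a`, to `0` off the ball of radius `b`,
and affine in the distance to the centre in between. -/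
noncomputable def radialBump (z : X) (a b : ℝ) (y : X) : ℝ :=
  max 0 (min 1 ((b - dist y z) / (b - a)))

theorem radialBump_nonneg (z : X) (a b : ℝ) (y : X) : 0 ≤ radialBump z a b y := le_max_left _ _

theorem radialBump_le_one (z : X) (a b : ℝ) (y : X) : radialBump z a b y ≤ 1 :=
  max_le zero_le_one (min_le_left _ _)

theorem continuous_radialBump (z : X) (a b : ℝ) : Continuous (radialBump z a b) := by
  unfold radialBump
  fun_prop

theorem radialBump_eq_one {z : X} {a b : ℝ} (hab : a < b) {y : X}
    (hy : y ∈ Metric.closedBall z a) : radialBump z a b y = 1 := by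
  have h1 : 1 ≤ (b - dist y z) / (b - a) := by
    rw [le_div_iff₀ (by linarith)]
    linarith [Metric.mem_closedBall.mp hy]
  rw [radialBump, min_eq_left h1, max_eq_right zero_le_one]

theorem radialBump_eq_zero {z : X} {a b : ℝ} (hab : a < b) {y : X}
    (hy : y ∉ Metric.ball z b) : radialBump z a b y = 0 := by
  have h1 : (b - dist y z) / (b - a) ≤ 0 := by
    refine div_nonpos_of_nonpos_of_nonneg ?_ (by linarith)
    rw [Metric.mem_ball, not_lt] at hy
    linarith
  exact max_eq_left ((min_le_right _ _).trans h1)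

theorem abs_radialBump_sub_le_one (z : X) (a b : ℝ) (x y : X) :
    |radialBump z a b x - radialBump z a b y| ≤ 1 := by
  have h1 := radialBump_nonneg z a b x
  have h2 := radialBump_nonneg z a b y
  have h3 := radialBump_le_one z a b x
  have h4 := radialBump_le_one z a b y
  rw [abs_le]; constructor <;> linarith

theorem abs_radialBump_sub_le (z : X) {a b : ℝ} (hab : a < b) (x y : X) :
    |radialBump z a b x - radialBump z a b y| ≤ dist x y / (b - a) := by
  have hL : 0 < b - a := by linarith
  have h1 : |(b - dist x z) / (b - a) - (b - dist y z) / (b - a)| ≤ dist x y / (b - a) := by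
    rw [← sub_div, abs_div, abs_of_pos hL]
    gcongr
    have := abs_dist_sub_le x y z
    rw [abs_sub_comm] at this
    rwa [show b - dist x z - (b - dist y z) = dist y z - dist x z by ring]
  refine (abs_max_sub_max_le_max _ _ _ _).trans ?_
  rw [sub_self, abs_zero]
  refine max_le (by positivity) ((abs_min_sub_min_le_max _ _ _ _).trans ?_)
  rw [sub_self, abs_zero]
  exact max_le (by positivity) h1

variable [MeasurableSpace X] {μ : Measure X} {p s : X → ℝ} {q : X → ℝ≥0∞}

/-- The standard vector gradient of a radial bump. -/
noncomputable def bumpGradient (s : X → ℝ) (z : X) (a b : ℝ) (k : ℤ) : X → ℝ≥0∞ :=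
  (Metric.ball z b).indicator fun y =>
    ENNReal.ofReal (min (1 / ((2 : ℝ) ^ k * (b - a))) 1 * ((2 : ℝ) ^ (k + 1)) ^ s y)

/-- At distance d in [2^{-k-1}, 2^{-k}) the bump oscillates by at most min(d/L, 1) ≤ min(1/(2^k L),
1), while d^s (2^{k+1})^s ≥ 1. One endpoint in the supporting ball suffices; if neither lies there,
both values vanish. -/
theorem isVectorGradient_bumpGradient [BorelSpace X] (hsm : Measurable s) (hs : ∀ x, 0 < s x)
    {z : X} {a b : ℝ} (hab : a < b) (E : Set X) :
    IsVectorGradient μ s E (radialBump z a b) (bumpGradient s z a b) := by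
  have hL : 0 < b - a := by linarith
  refine ⟨fun k => Measurable.indicator (by fun_prop) Metric.isOpen_ball.measurableSet,
    ∅, measure_empty, ?_⟩
  have key : ∀ (k : ℤ) (x y w : X), (2 : ℝ) ^ (-k - 1) ≤ dist x y → dist x y < (2 : ℝ) ^ (-k) →
      w ∈ Metric.ball z b →
      ENNReal.ofReal |radialBump z a b x - radialBump z a b y| ≤
        ENNReal.ofReal (dist x y ^ s w) * bumpGradient s z a b k w := by
    intro k x y w h1 h2 hw
    have hd : 0 < dist x y := lt_of_lt_of_le (by positivity) h1
    rw [bumpGradient, indicator_of_mem hw, ← ENNReal.ofReal_mul (by positivity)]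
    refine ENNReal.ofReal_le_ofReal ?_
    have h3 : 1 ≤ dist x y * (2 : ℝ) ^ (k + 1) := by
      calc (1 : ℝ) = (2 : ℝ) ^ (-k - 1) * (2 : ℝ) ^ (k + 1) := by
            rw [← zpow_add₀ two_ne_zero]; simp
        _ ≤ _ := by gcongr
    have h4 : 1 ≤ dist x y ^ s w * ((2 : ℝ) ^ (k + 1)) ^ s w := by
      rw [← Real.mul_rpow hd.le (by positivity)]
      exact Real.one_le_rpow h3 (hs w).le
    have h5 : |radialBump z a b x - radialBump z a b y| ≤ min (1 / ((2 : ℝ) ^ k * (b - a))) 1 := by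
      refine le_min ((abs_radialBump_sub_le z hab x y).trans ?_) (abs_radialBump_sub_le_one ..)
      rw [div_le_div_iff₀ hL (by positivity), one_mul, ← mul_assoc]
      refine mul_le_of_le_one_left hL.le ?_
      calc dist x y * (2 : ℝ) ^ k ≤ (2 : ℝ) ^ (-k) * (2 : ℝ) ^ k := by gcongr
        _ = 1 := by rw [← zpow_add₀ two_ne_zero]; simp
    have h6 : 0 ≤ min (1 / ((2 : ℝ) ^ k * (b - a))) 1 := by positivity
    calc _ ≤ min (1 / ((2 : ℝ) ^ k * (b - a))) 1 := h5
      _ ≤ min (1 / ((2 : ℝ) ^ k * (b - a))) 1 * (dist x y ^ s w * ((2 : ℝ) ^ (k + 1)) ^ s w) :=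
          le_mul_of_one_le_right h6 h4
      _ = _ := by ring
  rintro k x - y - h1 h2
  by_cases hx : x ∈ Metric.ball z b
  · exact (key k x y x h1 h2 hx).trans le_self_add
  · by_cases hy : y ∈ Metric.ball z b
    · exact (key k x y y h1 h2 hy).trans le_add_self
    · rw [radialBump_eq_zero hab hx, radialBump_eq_zero hab hy]
      simp

/-- `min(1/τ, 1) (2τ)^s L^{-s}`, the size of the `k`-th entry, `τ = 2^k L`. -/
theorem min_mul_rpow_eq {L σ : ℝ} (hL : 0 < L) (k : ℤ) :
    min (1 / ((2 : ℝ) ^ k * L)) 1 * ((2 : ℝ) ^ (k + 1)) ^ σ =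
      2 ^ σ * (min (1 / ((2 : ℝ) ^ k * L)) 1 * ((2 : ℝ) ^ k * L) ^ σ) * L ^ (-σ) := by
  rw [Real.mul_rpow (by positivity) hL.le, zpow_add_one₀ two_ne_zero,
    Real.mul_rpow (by positivity) zero_le_two, Real.rpow_neg hL.le]
  have : L ^ σ ≠ 0 := by positivity
  field_simp

/-- The endpoint estimate: at σ = 1 there is no decay for τ → ∞, so it serves only q = ∞. -/
theorem min_mul_rpow_le_one {τ σ : ℝ} (hτ : 0 < τ) (h0 : 0 ≤ σ) (h1 : σ ≤ 1) :
    min (1 / τ) 1 * τ ^ σ ≤ 1 := by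
  rcases le_total τ 1 with h | h
  · exact mul_le_one₀ (min_le_right _ _) (by positivity) (Real.rpow_le_one hτ.le h h0)
  · calc min (1 / τ) 1 * τ ^ σ ≤ 1 / τ * τ ^ (1 : ℝ) := by
          gcongr
          exact min_le_left _ _
      _ = 1 := by rw [Real.rpow_one]; field_simp

/-- The left side behaves like τ^σ for τ ≤ 1 and like τ^{σ-1} for τ ≥ 1. Any η below both s₀ and 1 -
s₁ is a rate of decay valid uniformly in σ. -/
theorem min_mul_rpow_le {τ σ s₀ s₁ η : ℝ} (hτ : 0 < τ) (h0 : s₀ ≤ σ) (h1 : σ ≤ s₁)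
    (hη0 : η ≤ s₀) (hη1 : η ≤ 1 - s₁) :
    min (1 / τ) 1 * τ ^ σ ≤ min τ (1 / τ) ^ η := by
  rcases le_total τ 1 with h | h
  · have h2 : τ ≤ 1 / τ := by rw [le_div_iff₀ hτ]; nlinarith
    rw [min_eq_left h2]
    calc min (1 / τ) 1 * τ ^ σ ≤ 1 * τ ^ σ := by gcongr; exact min_le_right _ _
      _ = τ ^ σ := one_mul _
      _ ≤ τ ^ η := Real.rpow_le_rpow_of_exponent_ge hτ h (by linarith)
  · have h2 : 1 / τ ≤ τ := by rw [div_le_iff₀ hτ]; nlinarith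
    rw [min_eq_right h2]
    calc min (1 / τ) 1 * τ ^ σ ≤ 1 / τ * τ ^ σ := by gcongr; exact min_le_left _ _
      _ = (1 / τ) ^ (1 - σ) := by
        rw [one_div, Real.inv_rpow hτ.le, ← Real.rpow_neg hτ.le, neg_sub,
          Real.rpow_sub hτ, Real.rpow_one]
        field_simp
      _ ≤ (1 / τ) ^ η := by
        refine Real.rpow_le_rpow_of_exponent_ge (by positivity) ?_ (by linarith)
        rw [div_le_iff₀ hτ]; linarith

theorem min_zpow_mul_rpow_le {L η : ℝ} {n k : ℤ} (hη0 : 0 ≤ η) (hη1 : η ≤ 1)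
    (h1 : (2 : ℝ) ^ n ≤ L) (h2 : L < (2 : ℝ) ^ (n + 1)) :
    min ((2 : ℝ) ^ k * L) (1 / ((2 : ℝ) ^ k * L)) ^ η ≤
      2 * ((2 : ℝ) ^ (-η)) ^ (k + n).natAbs := by
  have hL : 0 < L := lt_of_lt_of_le (by positivity) h1
  have hw : ((2 : ℝ) ^ (-η)) ^ (k + n).natAbs = (1 / 2 ^ (k + n).natAbs) ^ η := by
    rw [one_div, Real.inv_rpow (by positivity), ← Real.rpow_natCast, ← Real.rpow_natCast,
      ← Real.rpow_mul zero_le_two, ← Real.rpow_mul zero_le_two, ← Real.rpow_neg zero_le_two]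
    ring_nf
  have h3 : min ((2 : ℝ) ^ k * L) (1 / ((2 : ℝ) ^ k * L)) ≤ 2 * (1 / 2 ^ (k + n).natAbs) := by
    rcases le_total 0 (k + n) with h | h
    · refine (min_le_right _ _).trans ?_
      have : (2 : ℝ) ^ (k + n).natAbs ≤ 2 ^ k * L := by
        rw [← zpow_natCast, Int.natAbs_of_nonneg h, zpow_add₀ two_ne_zero]
        gcongr
      calc 1 / ((2 : ℝ) ^ k * L) ≤ 1 / 2 ^ (k + n).natAbs := by gcongr
        _ ≤ _ := le_mul_of_one_le_left (by positivity) one_le_two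
    · refine (min_le_left _ _).trans ?_
      rw [one_div, ← zpow_natCast, ← zpow_neg, Int.ofNat_natAbs_of_nonpos h, neg_neg]
      calc (2 : ℝ) ^ k * L ≤ 2 ^ k * 2 ^ (n + 1) := by gcongr
        _ = _ := by rw [zpow_add₀ two_ne_zero, zpow_add₀ two_ne_zero, zpow_one]; ring
  have h4 : 0 < min ((2 : ℝ) ^ k * L) (1 / ((2 : ℝ) ^ k * L)) := by positivity
  calc _ ≤ (2 * (1 / 2 ^ (k + n).natAbs)) ^ η := Real.rpow_le_rpow h4.le h3 hη0
    _ = 2 ^ η * (1 / 2 ^ (k + n).natAbs) ^ η := Real.mul_rpow zero_le_two (by positivity)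
    _ ≤ _ := by
      rw [hw]
      gcongr
      calc (2 : ℝ) ^ η ≤ 2 ^ (1 : ℝ) := Real.rpow_le_rpow_of_exponent_le one_le_two hη1
        _ = 2 := Real.rpow_one 2

theorem summable_pow_natAbs {w : ℝ} (h0 : 0 ≤ w) (h1 : w < 1) :
    Summable fun j : ℤ => w ^ j.natAbs := by
  refine Summable.of_nat_of_neg ?_ ?_ <;> simpa using summable_geometric_of_lt_one h0 h1

/-- Upper bound for the homogeneous quasi-norm of radial bumps, on both scales. -/
theorem exists_homNorm_radialBump_le [BorelSpace X] (A : HajlaszScale) (hp : ∀ x, 0 < p x)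
    (hsm : Measurable s) {s₀ s₁ : ℝ} (hs₀ : 0 < s₀) (hs₀' : ∀ x, s₀ ≤ s x)
    (hs₁0 : 0 < s₁) (hs₁ : ∀ x, s x ≤ s₁) {q₀ : ℝ} (hq₀ : 0 < q₀) (hq : ∀ᵐ x ∂μ, ENNReal.ofReal q₀ ≤ q x)
    (hsq : s₁ < 1 ∨ (s₁ ≤ 1 ∧ ∀ᵐ x ∂μ, q x = ∞)) :
    ∃ K : ℝ, 0 < K ∧ ∀ (z : X) (a b : ℝ), a < b → ∀ E : Set X, ∀ T : ℝ, 0 < T →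
      ∫⁻ y in Metric.ball z b, ENNReal.ofReal ((b - a) ^ (-s y) / T) ^ p y ∂μ ≤ 1 →
      homNorm A μ s p q E (radialBump z a b) ≤ ENNReal.ofReal (K * T) := by
  have hs : ∀ x, 0 < s x := fun x => hs₀.trans_le (hs₀' x)
  have hs₁1 : s₁ ≤ 1 := hsq.elim le_of_lt And.left
  have htwo : ∀ y, (2 : ℝ) ^ s y ≤ 2 := fun y => by
    calc (2 : ℝ) ^ s y ≤ 2 ^ (1 : ℝ) :=
          Real.rpow_le_rpow_of_exponent_le one_le_two ((hs₁ y).trans hs₁1)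
      _ = 2 := Real.rpow_one 2
  have hmod : ∀ (z : X) (a b : ℝ) (E : Set X) (T c : ℝ), 0 < T → 0 < c →
      ∫⁻ y in Metric.ball z b, ENNReal.ofReal ((b - a) ^ (-s y) / T) ^ p y ∂μ ≤ 1 →
      lebesgueModular (μ.restrict E) p (fun x => (Metric.ball z b).indicator
        (fun y => ENNReal.ofReal (c * (b - a) ^ (-s y))) x / ENNReal.ofReal (c * T)) ≤ 1 := by
    intro z a b E T c hT hc h
    rw [lebesgueModular_smul_indicator_div hp Metric.isOpen_ball.measurableSet hc hT]
    refine le_trans (lintegral_mono' (Measure.restrict_mono_measure Measure.restrict_le_self _)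
      le_rfl) h
  rcases hsq with hlt | ⟨-, hqt⟩
  · set η := min s₀ (1 - s₁) with hη
    have hη0 : 0 < η := lt_min hs₀ (by linarith)
    have hη1 : η ≤ 1 := (min_le_right _ _).trans (by linarith)
    set w : ℝ := 2 ^ (-η) with hw
    have hw0 : 0 < w := by positivity
    have hw1 : w < 1 := Real.rpow_lt_one_of_one_lt_of_neg one_lt_two (by linarith)
    have hwq0 : 0 < w ^ q₀ := by positivity
    have hwq1 : w ^ q₀ < 1 := Real.rpow_lt_one hw0.le hw1 hq₀
    have hsum := summable_pow_natAbs hwq0.le hwq1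
    set S := ∑' j : ℤ, (w ^ q₀) ^ j.natAbs with hS
    have hS0 : 0 ≤ S := tsum_nonneg fun j => by positivity
    -- Normalization: the q₀-th powers of c w^{|k+n|} sum to S/(1+S) ≤ 1. Shifting the index by n
    -- removes the scale L from the sum, so the final constant is uniform over all bumps.
    set c : ℝ := (1 + S) ^ (-q₀⁻¹) with hc
    have hc0 : 0 < c := by positivity
    have hcq : c ^ q₀ = (1 + S)⁻¹ := by
      rw [hc, ← Real.rpow_mul (by positivity), neg_mul, inv_mul_cancel₀ hq₀.ne', Real.rpow_neg_one]
    -- The 4 collects 2^{s(y)} ≤ 2 and the factor 2 lost in replacing 2^k L by 2^{k+n}.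
    refine ⟨4 / c, by positivity, fun z a b hab E T hT h => ?_⟩
    have hL : 0 < b - a := by linarith
    obtain ⟨n, hn1, hn2⟩ := exists_mem_Ico_zpow hL one_lt_two
    refine (iInf₂_le _ (isVectorGradient_bumpGradient hsm hs hab E)).trans ?_
    refine gradientNorm_le_of_tsum_le A hp hq₀ (ae_restrict_of_ae hq)
      (c := fun k => ENNReal.ofReal (c * w ^ (k + n).natAbs)) ?_ ?_ ?_
      (by positivity) ENNReal.ofReal_lt_top (hmod z a b E T (4 / c) hT (by positivity) h)
    · intro k
      exact ENNReal.ofReal_pos.mpr (by positivity)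
    · have h1 : ∀ k : ℤ, ENNReal.ofReal (c * w ^ (k + n).natAbs) ^ q₀ =
          ENNReal.ofReal (c ^ q₀) * ENNReal.ofReal ((w ^ q₀) ^ (k + n).natAbs) := by
        intro k
        rw [ENNReal.ofReal_rpow_of_pos (by positivity), ← ENNReal.ofReal_mul (by positivity),
          Real.mul_rpow hc0.le (by positivity), ← Real.rpow_natCast, ← Real.rpow_natCast,
          ← Real.rpow_mul hw0.le, ← Real.rpow_mul hw0.le, mul_comm q₀]
      rw [tsum_congr h1, ENNReal.tsum_mul_left,
        show ∑' k : ℤ, ENNReal.ofReal ((w ^ q₀) ^ (k + n).natAbs) =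
            ∑' j : ℤ, ENNReal.ofReal ((w ^ q₀) ^ j.natAbs) from (Equiv.addRight n).tsum_eq (fun j : ℤ => ENNReal.ofReal ((w ^ q₀) ^ j.natAbs)),
        ← ENNReal.ofReal_tsum_of_nonneg (fun j => by positivity) hsum, ← hS,
        ← ENNReal.ofReal_mul (by positivity), ENNReal.ofReal_le_one, hcq,
        inv_mul_le_iff₀ (by positivity)]
      linarith
    · refine Filter.Eventually.of_forall fun y k => ?_
      by_cases hy : y ∈ Metric.ball z b
      · rw [bumpGradient, indicator_of_mem hy, indicator_of_mem hy,
          ← ENNReal.ofReal_mul (by positivity)]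
        refine ENNReal.ofReal_le_ofReal ?_
        rw [min_mul_rpow_eq hL]
        have h2 := (min_mul_rpow_le (τ := 2 ^ k * (b - a)) (by positivity) (hs₀' y) (hs₁ y)
          (min_le_left _ _) (min_le_right _ _)).trans
          (min_zpow_mul_rpow_le hη0.le hη1 hn1 hn2 (k := k))
        calc _ ≤ 2 * (2 * w ^ (k + n).natAbs) * (b - a) ^ (-s y) := by
              gcongr
              exact htwo y
          _ = _ := by field_simp; ring
      · rw [bumpGradient, indicator_of_notMem hy]
        exact zero_le
  · refine ⟨2, two_pos, fun z a b hab E T hT h => ?_⟩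
    have hL : 0 < b - a := by linarith
    refine (iInf₂_le _ (isVectorGradient_bumpGradient hsm hs hab E)).trans ?_
    refine gradientNorm_le_of_le_of_eq_top A hp (ae_restrict_of_ae hqt) ?_
      (by positivity) ENNReal.ofReal_lt_top (hmod z a b E T 2 hT two_pos h)
    refine Filter.Eventually.of_forall fun y k => ?_
    by_cases hy : y ∈ Metric.ball z b
    · rw [bumpGradient, indicator_of_mem hy, indicator_of_mem hy]
      refine ENNReal.ofReal_le_ofReal ?_
      rw [min_mul_rpow_eq hL]
      have h2 := min_mul_rpow_le_one (τ := 2 ^ k * (b - a)) (by positivity) (hs y).le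
        ((hs₁ y).trans hs₁1)
      calc _ ≤ 2 * 1 * (b - a) ^ (-s y) := by
            gcongr
            exact htwo y
        _ = _ := by ring
    · rw [bumpGradient, indicator_of_notMem hy]
      exact zero_le

end Bump

/-! ### Log-Hölder exponents -/

section Exponents

section Measurable

variable {X : Type*} [MeasurableSpace X] {μ : Measure X} {p : X → ℝ}

theorem IsExponent.exists_real_lower_bound {q : X → ℝ≥0∞} (hq : IsExponent μ q) :
    ∃ q₀ : ℝ, 0 < q₀ ∧ ∀ᵐ x ∂μ, ENNReal.ofReal q₀ ≤ q x := by
  obtain ⟨-, -, h⟩ := hq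
  have h1 : min (essInf q μ) 1 ≠ ∞ := ((min_le_right _ _).trans_lt ENNReal.one_lt_top).ne
  refine ⟨(min (essInf q μ) 1).toReal,
    ENNReal.toReal_pos (lt_min h one_pos).ne' h1, ?_⟩
  filter_upwards [ae_essInf_le (f := q) (μ := μ)] with x hx
  rw [ENNReal.ofReal_toReal h1]
  exact (min_le_left _ _).trans hx

/-- With s frozen at its upper bound a, the integrand is at most v^{-β p(y)} ≤ 1/v on a set of
measure at most v. Whether β must bound 1/p from below or from above depends on v ≤ 1 or v ≥ 1,
hence the abstract hypothesis `hv`. -/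
theorem lintegral_rpow_div_le_one_aux {s : X → ℝ} (hp : ∀ x, 0 < p x) {B : Set X}
    (hB : MeasurableSet B) {L a β v : ℝ} (hL : 0 < L) (hL1 : L ≤ 1) (hs : ∀ y ∈ B, s y ≤ a)
    (hv0 : 0 < v) (hv : ∀ y ∈ B, v ^ (-β * p y) ≤ v ^ (-1 : ℝ)) (hvB : μ B ≤ ENNReal.ofReal v) :
    ∫⁻ y in B, ENNReal.ofReal (L ^ (-s y) / (L ^ (-a) * v ^ β)) ^ p y ∂μ ≤ 1 := by
  calc ∫⁻ y in B, ENNReal.ofReal (L ^ (-s y) / (L ^ (-a) * v ^ β)) ^ p y ∂μ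
      ≤ ∫⁻ _ in B, ENNReal.ofReal v⁻¹ ∂μ := by
        refine setLIntegral_mono' hB fun y hy => ?_
        rw [ENNReal.ofReal_rpow_of_pos (by positivity)]
        refine ENNReal.ofReal_le_ofReal ?_
        have h1 : L ^ (-s y) ≤ L ^ (-a) :=
          Real.rpow_le_rpow_of_exponent_ge hL hL1 (by linarith [hs y hy])
        have h2 : L ^ (-s y) / (L ^ (-a) * v ^ β) ≤ v ^ (-β) := by
          rw [div_le_iff₀ (by positivity), Real.rpow_neg hv0.le]
          have : (v ^ β)⁻¹ * (L ^ (-a) * v ^ β) = L ^ (-a) := by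
            field_simp
          rwa [this]
        calc _ ≤ (v ^ (-β)) ^ p y := Real.rpow_le_rpow (by positivity) h2 (hp y).le
          _ = v ^ (-β * p y) := (Real.rpow_mul hv0.le _ _).symm
          _ ≤ v ^ (-1 : ℝ) := hv y hy
          _ = v⁻¹ := Real.rpow_neg_one v
    _ = ENNReal.ofReal v⁻¹ * μ B := by simp
    _ ≤ ENNReal.ofReal v⁻¹ * ENNReal.ofReal v := by gcongr
    _ = 1 := by
      rw [← ENNReal.ofReal_mul (by positivity), inv_mul_cancel₀ hv0.ne', ENNReal.ofReal_one]

/-- An admissible value of the quasi-norm of `L ^ (-s)` on a set of measure at most `v`. -/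
theorem lintegral_rpow_div_le_one {s : X → ℝ} (hp : ∀ x, 0 < p x) {B : Set X}
    (hB : MeasurableSet B)
    {L a β v : ℝ} (hL : 0 < L) (hL1 : L ≤ 1) (hs : ∀ y ∈ B, s y ≤ a) (hβ : ∀ y ∈ B, β ≤ 1 / p y)
    (hv0 : 0 < v) (hv1 : v ≤ 1) (hvB : μ B ≤ ENNReal.ofReal v) :
    ∫⁻ y in B, ENNReal.ofReal (L ^ (-s y) / (L ^ (-a) * v ^ β)) ^ p y ∂μ ≤ 1 := by
  refine lintegral_rpow_div_le_one_aux hp hB hL hL1 hs hv0 (fun y hy => ?_) hvB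
  refine Real.rpow_le_rpow_of_exponent_ge hv0 hv1 ?_
  have := hβ y hy
  rw [le_div_iff₀ (hp y)] at this
  linarith

/-- The variant of the preceding bound for sets of large measure. -/
theorem lintegral_rpow_div_le_one_of_one_le {s : X → ℝ} (hp : ∀ x, 0 < p x) {B : Set X}
    (hB : MeasurableSet B) {L a β v : ℝ} (hL : 0 < L) (hL1 : L ≤ 1) (hs : ∀ y ∈ B, s y ≤ a)
    (hβ : ∀ y ∈ B, 1 / p y ≤ β) (hv1 : 1 ≤ v) (hvB : μ B ≤ ENNReal.ofReal v) :
    ∫⁻ y in B, ENNReal.ofReal (L ^ (-s y) / (L ^ (-a) * v ^ β)) ^ p y ∂μ ≤ 1 := by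
  have hv0 : 0 < v := by linarith
  refine lintegral_rpow_div_le_one_aux hp hB hL hL1 hs hv0 (fun y hy => ?_) hvB
  refine Real.rpow_le_rpow_of_exponent_le hv1 ?_
  have := hβ y hy
  rw [div_le_iff₀ (hp y)] at this
  linarith

end Measurable

variable {X : Type*} [MetricSpace X]

/-- The form used throughout: the oscillation at scale r is O(1/log(1/r)), so its product with
log(1/r) stays bounded. -/
theorem LogHolder.exists_abs_sub_le {f : X → ℝ} (hf : LogHolder f) :
    ∃ C : ℝ, 0 < C ∧ ∀ (x y : X) (r : ℝ), 0 < r → r < 1 → dist x y < r →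
      |f x - f y| ≤ C / Real.log (1 / r) := by
  obtain ⟨C, hC, h⟩ := hf
  refine ⟨C, hC, fun x y r hr hr1 hxy => ?_⟩
  have hlog : 0 < Real.log (1 / r) := Real.log_pos (by rw [lt_div_iff₀ hr]; linarith)
  rcases eq_or_ne x y with rfl | hne
  · simp only [sub_self, abs_zero]
    positivity
  · have hd : 0 < dist x y := dist_pos.mpr hne
    refine (h x y hne).trans ?_
    gcongr
    have : 1 / r ≤ 1 / dist x y := by gcongr
    linarith [Real.exp_pos 1]

theorem LogHolder.continuous {f : X → ℝ} (hf : LogHolder f) : Continuous f := by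
  obtain ⟨C, hC, h⟩ := hf.exists_abs_sub_le
  rw [Metric.continuous_iff]
  intro x ε hε
  -- This radius makes log(1/r) = C/ε + 1, so that C/log(1/r) < ε.
  refine ⟨Real.exp (-(C / ε + 1)), Real.exp_pos _, fun y hy => ?_⟩
  have hpos : 0 < C / ε := by positivity
  have h1 := h y x _ (Real.exp_pos _) (by rw [Real.exp_lt_one_iff]; linarith) hy
  rw [Real.dist_eq]
  refine h1.trans_lt ?_
  rw [one_div, ← Real.exp_neg, Real.log_exp, neg_neg, div_lt_iff₀ (by positivity)]
  have : ε * (C / ε + 1) = C + ε := by field_simp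
  linarith

variable [MeasurableSpace X] {μ : Measure X} {p : X → ℝ}

theorem IsMetricMeasure.isOpenPosMeasure (hμ : IsMetricMeasure μ) : μ.IsOpenPosMeasure := by
  refine ⟨fun U hU ⟨x, hx⟩ h0 => ?_⟩
  obtain ⟨ε, hε, hsub⟩ := Metric.isOpen_iff.mp hU x hx
  exact absurd (measure_mono_null hsub h0) (hμ x ε hε).1.ne'

/-- The set where the inequality fails is open and null, hence empty. This turns essential bounds on
log-Hölder exponents into pointwise ones. -/
theorem le_of_ae_le_of_continuous [μ.IsOpenPosMeasure] {f g : X → ℝ} (hf : Continuous f)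
    (hg : Continuous g) (h : ∀ᵐ x ∂μ, f x ≤ g x) (x : X) : f x ≤ g x := by
  have h0 : μ {x | g x < f x} = 0 := by simpa only [ae_iff, not_le] using h
  have h1 := ((isOpen_lt hg hf).measure_eq_zero_iff μ).mp h0
  by_contra! hx
  exact (h1 ▸ hx : x ∈ (∅ : Set X))

theorem IsBddLogExponent.continuous (hp : IsBddLogExponent μ p) : Continuous p := by
  have h := hp.2.continuous.inv₀ fun x => (one_div_pos.mpr (hp.1.2.1 x)).ne'
  convert h using 1
  ext x
  simp

theorem IsBddLogExponent.exists_bounds (hμ : IsMetricMeasure μ) (hp : IsBddLogExponent μ p) :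
    ∃ m M : ℝ, 0 < m ∧ 0 < M ∧ (∀ x, m ≤ p x) ∧ ∀ x, p x ≤ M := by
  have := hμ.isOpenPosMeasure
  obtain ⟨-, hp0, ⟨m, hm, hmp⟩, M, hM⟩ := hp.1
  refine ⟨m, max M 1, hm, by positivity, le_of_ae_le_of_continuous continuous_const hp.continuous hmp,
    fun x => (le_of_ae_le_of_continuous hp.continuous continuous_const hM x).trans (le_max_left _ _)⟩

theorem IsBddLogExponent.exists_abs_sub_le (hμ : IsMetricMeasure μ) (hp : IsBddLogExponent μ p) :
    ∃ C : ℝ, 0 < C ∧ ∀ (x y : X) (r : ℝ), 0 < r → r < 1 → dist x y < r →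
      |p x - p y| ≤ C / Real.log (1 / r) := by
  obtain ⟨m, M, hm, hM, hmp, hMp⟩ := hp.exists_bounds hμ
  obtain ⟨C, hC, h⟩ := hp.2.exists_abs_sub_le
  refine ⟨M * M * C, by positivity, fun x y r hr hr1 hxy => ?_⟩
  have hx := hp.1.2.1 x
  have hy := hp.1.2.1 y
  have h1 : p x - p y = -(p x * p y) * (1 / p x - 1 / p y) := by field_simp; ring
  rw [h1, abs_mul, abs_neg, abs_of_pos (by positivity), mul_div_assoc]
  gcongr
  · exact hMp x
  · exact hMp y
  · exact h x y r hr hr1 hxy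

theorem ExponentGG.exists_forall_le (hμ : IsMetricMeasure μ) {γ : X → ℝ}
    (hp : IsBddLogExponent μ p) (hγ : IsBddLogExponent μ γ) (h : ExponentGG μ γ p) :
    ∃ ε : ℝ, 0 < ε ∧ ∀ x, ε ≤ γ x - p x := by
  have := hμ.isOpenPosMeasure
  obtain ⟨ε, hε, h⟩ := h
  exact ⟨ε, hε, le_of_ae_le_of_continuous continuous_const (hγ.continuous.sub hp.continuous) h⟩

theorem SmoothnessAdmissible.exists_upper_bound [Nonempty X] (hμ : IsMetricMeasure μ) {s : X → ℝ}
    {q : X → ℝ≥0∞} (hs : IsBddLogExponent μ s) (h : SmoothnessAdmissible μ s q) :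
    ∃ s₁ : ℝ, 0 < s₁ ∧ (∀ x, s x ≤ s₁) ∧ (s₁ < 1 ∨ (s₁ ≤ 1 ∧ ∀ᵐ x ∂μ, q x = ∞)) := by
  have := hμ.isOpenPosMeasure
  obtain ⟨h1, h2⟩ := h
  set e := essSup (fun x => ENNReal.ofReal (s x)) μ with he
  have hfin : e ≠ ∞ := (h1.trans_lt ENNReal.one_lt_top).ne
  have hle : ∀ x, s x ≤ e.toReal := by
    refine le_of_ae_le_of_continuous (μ := μ) hs.continuous continuous_const ?_
    filter_upwards [ENNReal.ae_le_essSup (μ := μ) fun x => ENNReal.ofReal (s x)] with x hx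
    exact (ENNReal.ofReal_le_iff_le_toReal hfin).mp hx
  refine ⟨e.toReal, (hs.1.2.1 (Classical.arbitrary X)).trans_le (hle _), hle, ?_⟩
  rcases h1.lt_or_eq with hlt | heq
  · left
    rw [← ENNReal.toReal_one]
    exact (ENNReal.toReal_lt_toReal hfin ENNReal.one_ne_top).mpr hlt
  · right
    refine ⟨by rw [heq, ENNReal.toReal_one], ?_⟩
    filter_upwards [ae_essInf_le (f := q) (μ := μ)] with x hx
    rw [h2 heq] at hx
    exact top_le_iff.mp hx

end Exponents

/-! ### Iteration over radii that halve the measure -/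

section Iteration

variable {X : Type*} [MetricSpace X] [MeasurableSpace X] {μ : Measure X}

theorem IsMetricMeasure.measure_ball_ne_top (hμ : IsMetricMeasure μ) (x : X) (r : ℝ) :
    μ (Metric.ball x r) ≠ ∞ := by
  rcases le_or_gt r 0 with h | h
  · simp [Metric.ball_eq_empty.mpr h]
  · exact (hμ x r h).2.ne

theorem IsMetricMeasure.real_ball_pos (hμ : IsMetricMeasure μ) (x : X) {r : ℝ} (hr : 0 < r) :
    0 < μ.real (Metric.ball x r) :=
  ENNReal.toReal_pos (hμ x r hr).1.ne' (hμ x r hr).2.ne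

theorem IsMetricMeasure.measure_closedBall_ne_top (hμ : IsMetricMeasure μ) (x : X) (r : ℝ) :
    μ (Metric.closedBall x r) ≠ ∞ :=
  measure_ne_top_of_subset (Metric.closedBall_subset_ball (lt_add_one r))
    (hμ.measure_ball_ne_top x _)

theorem IsMetricMeasure.real_ball_mono (hμ : IsMetricMeasure μ) (x : X) {r t : ℝ} (h : r ≤ t) :
    μ.real (Metric.ball x r) ≤ μ.real (Metric.ball x t) :=
  measureReal_mono (Metric.ball_subset_ball h) (hμ.measure_ball_ne_top x t)

theorem IsMetricMeasure.ofReal_real_closedBall (hμ : IsMetricMeasure μ) (z : X) (a : ℝ) :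
    ENNReal.ofReal (μ.real (Metric.closedBall z a)) = μ (Metric.closedBall z a) :=
  ENNReal.ofReal_toReal (hμ.measure_closedBall_ne_top z a)

theorem IsMetricMeasure.ofReal_real_ball (hμ : IsMetricMeasure μ) (z : X) (a : ℝ) :
    ENNReal.ofReal (μ.real (Metric.ball z a)) = μ (Metric.ball z a) :=
  ENNReal.ofReal_toReal (hμ.measure_ball_ne_top z a)

theorem IsMetricMeasure.real_closedBall_le (hμ : IsMetricMeasure μ) (z : X) {a b : ℝ} (hab : a < b) :
    μ.real (Metric.closedBall z a) ≤ μ.real (Metric.ball z b) :=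
  measureReal_mono (Metric.closedBall_subset_ball hab) (hμ.measure_ball_ne_top z b)

/-- Continuity from below: an open ball is the increasing union of the open balls of smaller radii.
-/
theorem real_ball_le_of_forall_lt (hμ : IsMetricMeasure μ) (x : X) {t c : ℝ}
    (h : ∀ r < t, μ.real (Metric.ball x r) ≤ c) : μ.real (Metric.ball x t) ≤ c := by
  have hU : Metric.ball x t = ⋃ n : ℕ, Metric.ball x (t - 1 / (n + 1)) := by
    ext y
    simp only [Metric.mem_ball, mem_iUnion]
    refine ⟨fun hy => ?_, fun ⟨n, hn⟩ => hn.trans (by linarith [Nat.one_div_pos_of_nat (α := ℝ) (n := n)])⟩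
    obtain ⟨n, hn⟩ := exists_nat_one_div_lt (sub_pos.mpr hy)
    exact ⟨n, by linarith⟩
  have hmono : Monotone fun n : ℕ => Metric.ball x (t - 1 / ((n : ℝ) + 1)) := by
    intro m n hmn
    refine Metric.ball_subset_ball ?_
    have := Nat.one_div_le_one_div (α := ℝ) hmn
    linarith
  have hlim := tendsto_measure_iUnion_atTop (μ := μ) hmono
  rw [← hU] at hlim
  have hlim' := (ENNReal.tendsto_toReal (hμ.measure_ball_ne_top x t)).comp hlim
  refine le_of_tendsto' hlim' fun n => h _ ?_
  linarith [Nat.one_div_pos_of_nat (α := ℝ) (n := n)]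

variable [BorelSpace X]

/-- Continuity from above, which produces the closed ball. The estimates for bumps therefore use a
closed inner ball and an open outer one. -/
theorem le_real_closedBall_of_forall_lt (hμ : IsMetricMeasure μ) (x : X) {t t₁ c : ℝ} (ht : t < t₁)
    (h : ∀ r, t < r → r ≤ t₁ → c ≤ μ.real (Metric.ball x r)) :
    c ≤ μ.real (Metric.closedBall x t) := by
  have hI : Metric.closedBall x t = ⋂ n : ℕ, Metric.ball x (t + 1 / (n + 1)) := by
    ext y
    simp only [Metric.mem_ball, Metric.mem_closedBall, mem_iInter]
    refine ⟨fun hy n => by linarith [Nat.one_div_pos_of_nat (α := ℝ) (n := n)], fun hy => ?_⟩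
    by_contra! hlt
    obtain ⟨n, hn⟩ := exists_nat_one_div_lt (sub_pos.mpr hlt)
    linarith [hy n]
  have hanti : Antitone fun n : ℕ => Metric.ball x (t + 1 / ((n : ℝ) + 1)) := by
    intro m n hmn
    refine Metric.ball_subset_ball ?_
    have := Nat.one_div_le_one_div (α := ℝ) hmn
    linarith
  have hlim := tendsto_measure_iInter_atTop (μ := μ)
    (fun n => Metric.isOpen_ball.measurableSet.nullMeasurableSet) hanti
    ⟨0, hμ.measure_ball_ne_top x _⟩
  rw [← hI] at hlim
  have hlim' := (ENNReal.tendsto_toReal (hμ.measure_closedBall_ne_top x t)).comp hlim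
  refine ge_of_tendsto hlim' ?_
  obtain ⟨N, hN⟩ := exists_nat_one_div_lt (sub_pos.mpr ht)
  filter_upwards [Filter.eventually_ge_atTop N] with n hn
  refine h _ (by linarith [Nat.one_div_pos_of_nat (α := ℝ) (n := n)]) ?_
  have := Nat.one_div_le_one_div (α := ℝ) hn
  linarith

/-- A radius at which the measure of a ball drops to one half. -/
theorem exists_radius_half (hμ : IsMetricMeasure μ) (x : X) {t : ℝ} (ht : 0 < t) :
    ∃ t', 0 ≤ t' ∧ t' < t ∧ μ.real (Metric.ball x t') ≤ μ.real (Metric.ball x t) / 2 ∧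
      μ.real (Metric.ball x t) ≤ 2 * μ.real (Metric.closedBall x t') := by
  have hpos := hμ.real_ball_pos x ht
  set v := μ.real (Metric.ball x t) with hv
  set S := {r : ℝ | μ.real (Metric.ball x r) ≤ v / 2} with hS
  have hlt : ∀ r ∈ S, r < t := by
    intro r hr
    by_contra! h
    have h1 := hμ.real_ball_mono x h
    have h2 : μ.real (Metric.ball x r) ≤ v / 2 := hr
    linarith
  have h0 : (0 : ℝ) ∈ S := by
    simp only [hS, mem_ofPred_eq, Metric.ball_zero, measureReal_empty]
    linarith
  have hbdd : BddAbove S := ⟨t, fun r hr => (hlt r hr).le⟩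
  -- The supremum of the radii carrying at most half the measure is itself such a radius, by
  -- continuity from below. Larger radii carry more than half, which passes to the closed ball.
  have hmem : μ.real (Metric.ball x (sSup S)) ≤ v / 2 := by
    refine real_ball_le_of_forall_lt hμ x fun r hr => ?_
    obtain ⟨r', hr', hrr'⟩ := exists_lt_of_lt_csSup ⟨0, h0⟩ hr
    exact (hμ.real_ball_mono x hrr'.le).trans hr'
  refine ⟨sSup S, le_csSup hbdd h0, hlt _ hmem, hmem, ?_⟩
  have := le_real_closedBall_of_forall_lt hμ x (hlt _ hmem) (c := v / 2) fun r hr _ => by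
    by_contra! h
    exact absurd (le_csSup hbdd (show r ∈ S from h.le)) (not_le.mpr hr)
  linarith

/-- If gaps between radii are controlled by a power of the measure whenever the measure drops at
most by half, then so is the radius itself. -/
theorem radius_rpow_le_of_gap (hμ : IsMetricMeasure μ) (z : X) {ρ a a₁ b₀ β K : ℝ}
    (hρ : 0 < ρ) (ha : 0 < a) (ha₁ : a ≤ a₁) (hb₀ : 0 < b₀) (hβ : b₀ * a ≤ β) (hK : 0 < K)
    (h : ∀ t' t : ℝ, 0 ≤ t' → t' < t → t ≤ ρ →
      μ.real (Metric.ball z t) ≤ 2 * μ.real (Metric.closedBall z t') →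
      (t - t') ^ a ≤ K * μ.real (Metric.ball z t) ^ β) :
    ρ ^ a ≤ K * ((1 - 2 ^ (-b₀))⁻¹) ^ a₁ * μ.real (Metric.ball z ρ) ^ β := by
  set φ : ℝ → ℝ := fun t => μ.real (Metric.ball z t) with hφ
  have hφ0 : ∀ t, 0 ≤ φ t := fun t => measureReal_nonneg
  set b := β / a with hb
  have hbb : b₀ ≤ b := by rw [hb, le_div_iff₀ ha]; exact hβ
  have hb0 : 0 < b := hb₀.trans_le hbb
  have hw1 : (2 : ℝ) ^ (-b₀) < 1 := Real.rpow_lt_one_of_one_lt_of_neg one_lt_two (by linarith)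
  have hwb : (2 : ℝ) ^ (-b) ≤ 2 ^ (-b₀) :=
    Real.rpow_le_rpow_of_exponent_le one_le_two (by linarith)
  set K₁ := K ^ (1 / a) with hK₁
  have hK₁0 : 0 < K₁ := by positivity
  have hd : 0 < 1 - (2 : ℝ) ^ (-b₀) := by linarith
  set C := K₁ * (1 - (2 : ℝ) ^ (-b₀))⁻¹ with hC
  have hC0 : 0 < C := by positivity
  -- C is K₁ times the sum of the geometric series with ratio 2^{-b₀}, hence stable under one
  -- halving step.
  have hCK : K₁ + C * 2 ^ (-b) ≤ C := by
    have : C * (1 - (2 : ℝ) ^ (-b₀)) = K₁ := by rw [hC]; field_simp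
    nlinarith
  have hroot : ∀ y, 0 ≤ y → (K * y ^ β) ^ (1 / a) = K₁ * y ^ b := by
    intro y hy
    rw [Real.mul_rpow hK.le (by positivity), ← Real.rpow_mul hy, mul_one_div]
  have hgap : ∀ t' t : ℝ, 0 ≤ t' → t' < t → t ≤ ρ → φ t ≤ 2 * μ.real (Metric.closedBall z t') →
      t - t' ≤ K₁ * φ t ^ b := by
    intro t' t h0 h1 h2 h3
    rw [← hroot _ (hφ0 t)]
    calc t - t' = ((t - t') ^ a) ^ (1 / a) := by
          rw [← Real.rpow_mul (by linarith), mul_one_div_cancel ha.ne', Real.rpow_one]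
      _ ≤ _ := Real.rpow_le_rpow (Real.rpow_nonneg (by linarith) _) (h t' t h0 h1 h2 h3)
          (by positivity)
  have hmain : ρ ≤ C * φ ρ ^ b := by
    by_contra! hbad
    -- Along the halving radii t - C φ(t)^b never decreases, so every t stays at least e while φ(t)
    -- ≤ φ(ρ)/2^n. This contradicts the positive measure of the ball of radius e.
    set e := ρ - C * φ ρ ^ b with he
    have he0 : 0 < e := by linarith
    have hstep : ∀ n : ℕ, ∃ t, t ≤ ρ ∧ e ≤ t - C * φ t ^ b ∧ φ t ≤ φ ρ / 2 ^ n := by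
      intro n
      induction n with
      | zero => exact ⟨ρ, le_rfl, le_rfl, by simp⟩
      | succ n ih =>
        obtain ⟨t, ht, hte, htn⟩ := ih
        have hpow : 0 ≤ φ t ^ b := Real.rpow_nonneg (hφ0 t) _
        have ht0 : 0 < t := by nlinarith
        obtain ⟨t', h0, h1, h2, h3⟩ := exists_radius_half hμ z ht0
        refine ⟨t', h1.le.trans ht, ?_, ?_⟩
        · have h4 := hgap t' t h0 h1 ht h3
          have h5 : φ t' ^ b ≤ 2 ^ (-b) * φ t ^ b := by
            calc φ t' ^ b ≤ (φ t / 2) ^ b := Real.rpow_le_rpow (hφ0 t') h2 hb0.le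
              _ = _ := by
                rw [Real.div_rpow (hφ0 t) zero_le_two, Real.rpow_neg zero_le_two]
                field_simp
          have h6 : C * φ t' ^ b ≤ C * 2 ^ (-b) * φ t ^ b := by
            have := mul_le_mul_of_nonneg_left h5 hC0.le
            linarith
          have h7 : (K₁ + C * 2 ^ (-b)) * φ t ^ b ≤ C * φ t ^ b := by gcongr
          linarith
        · rw [pow_succ, ← div_div]
          exact h2.trans (by gcongr)
    have hpe : 0 < φ e := hμ.real_ball_pos z he0
    have hall : ∀ n : ℕ, φ e ≤ φ ρ * (1 / 2) ^ n := by
      intro n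
      obtain ⟨t, -, hte, htn⟩ := hstep n
      have hpow : 0 ≤ φ t ^ b := Real.rpow_nonneg (hφ0 t) _
      refine (hμ.real_ball_mono z (by nlinarith)).trans (htn.trans (le_of_eq ?_))
      rw [one_div, inv_pow, div_eq_mul_inv]
    have hlim : Filter.Tendsto (fun n : ℕ => φ ρ * (1 / 2 : ℝ) ^ n) Filter.atTop (nhds (φ ρ * 0)) :=
      (tendsto_pow_atTop_nhds_zero_of_lt_one (by norm_num) (by norm_num)).const_mul _
    have := ge_of_tendsto' hlim hall
    linarith
  have hD1 : 1 ≤ (1 - (2 : ℝ) ^ (-b₀))⁻¹ := by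
    rw [one_le_inv₀ hd]
    linarith [Real.rpow_pos_of_pos two_pos (-b₀)]
  calc ρ ^ a ≤ (C * φ ρ ^ b) ^ a := Real.rpow_le_rpow hρ.le hmain ha.le
    _ = K * ((1 - 2 ^ (-b₀))⁻¹) ^ a * φ ρ ^ β := by
      rw [Real.mul_rpow hC0.le (Real.rpow_nonneg (hφ0 ρ) _), hC,
        Real.mul_rpow hK₁0.le (by positivity), hK₁, ← Real.rpow_mul hK.le, ← Real.rpow_mul (hφ0 ρ),
        one_div_mul_cancel ha.ne', Real.rpow_one, hb, div_mul_cancel₀ _ ha.ne']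
    _ ≤ K * ((1 - 2 ^ (-b₀))⁻¹) ^ a₁ * φ ρ ^ β := by
      have := hφ0 ρ
      gcongr

end Iteration

/-- Absorption of log-Hölder errors: `m = log (1/μ)`, `l = log (1/r)`, with `d l` bounded. -/
theorem absorb_log_error {W B d m A S S₁ l κ C d₁ : ℝ} (hW : 0 ≤ W) (hκ : 0 < κ) (hB : κ ≤ B)
    (hd : 0 ≤ d) (hdκ : 2 * d ≤ κ / 2) (hd1 : d ≤ d₁) (hm : 0 ≤ m) (hdl : d * l ≤ C)
    (hl : 0 ≤ l) (hA : 0 ≤ A) (hS : S ≤ S₁) (hS₁ : 0 ≤ S₁)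
    (h : W + (B - 2 * d) * m ≤ A + (S + d) * l) :
    W + B * m ≤ (A + C + 4 / κ * (d₁ * A + S₁ * C + d₁ * C)) + S * l := by
  have hC : 0 ≤ C := (mul_nonneg hd hl).trans hdl
  -- A crude bound of m by a multiple of l, enough to control the product d m because d l ≤ C.
  have h1 : κ / 2 * m ≤ A + S₁ * l + C := by nlinarith
  have h2 : κ / 2 * (d * m) ≤ d₁ * A + S₁ * C + d₁ * C := by
    have e1 : d * (κ / 2 * m) ≤ d * (A + S₁ * l + C) := by gcongr
    nlinarith [mul_le_mul_of_nonneg_right hd1 hA, mul_le_mul_of_nonneg_right hd1 hC,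
      mul_le_mul_of_nonneg_left hdl hS₁]
  have h3 : 2 * (d * m) ≤ 4 / κ * (d₁ * A + S₁ * C + d₁ * C) := by
    rw [div_mul_eq_mul_div, le_div_iff₀ hκ]
    linarith
  nlinarith

/-! ### From estimates for bumps to lower bounds for the measure -/

section LowerBounds

variable {X : Type*} [MetricSpace X]

/-- The choice d = C/log(1/r) works, and r₁ = exp(-C/d₁) makes it at most d₁. A single d serves
three exponents at once. -/
theorem exists_uniform_oscillation {f₁ f₂ f₃ : X → ℝ} {d₁ : ℝ} (hd₁ : 0 < d₁)
    (h₁ : ∃ C : ℝ, 0 < C ∧ ∀ (x y : X) (r : ℝ), 0 < r → r < 1 → dist x y < r →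
      |f₁ x - f₁ y| ≤ C / Real.log (1 / r))
    (h₂ : ∃ C : ℝ, 0 < C ∧ ∀ (x y : X) (r : ℝ), 0 < r → r < 1 → dist x y < r →
      |f₂ x - f₂ y| ≤ C / Real.log (1 / r))
    (h₃ : ∃ C : ℝ, 0 < C ∧ ∀ (x y : X) (r : ℝ), 0 < r → r < 1 → dist x y < r →
      |f₃ x - f₃ y| ≤ C / Real.log (1 / r)) :
    ∃ C r₁ : ℝ, 0 < C ∧ 0 < r₁ ∧ r₁ < 1 ∧ ∀ (x : X) (r : ℝ), 0 < r → r ≤ r₁ →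
      ∃ d : ℝ, 0 ≤ d ∧ d ≤ d₁ ∧ d * Real.log (1 / r) ≤ C ∧ ∀ y ∈ Metric.ball x r,
        |f₁ x - f₁ y| ≤ d ∧ |f₂ x - f₂ y| ≤ d ∧ |f₃ x - f₃ y| ≤ d := by
  obtain ⟨C₁, hC₁, h₁⟩ := h₁
  obtain ⟨C₂, hC₂, h₂⟩ := h₂
  obtain ⟨C₃, hC₃, h₃⟩ := h₃
  set C := C₁ + C₂ + C₃ with hC
  have hC0 : 0 < C := by positivity
  refine ⟨C, Real.exp (-(C / d₁)), hC0, Real.exp_pos _, ?_, fun x r hr hr1 => ?_⟩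
  · rw [Real.exp_lt_one_iff, neg_lt_zero]; positivity
  have hlt : r < 1 := hr1.trans_lt (by rw [Real.exp_lt_one_iff, neg_lt_zero]; positivity)
  have hl : C / d₁ ≤ Real.log (1 / r) := by
    rw [one_div, Real.log_inv, le_neg]
    exact (Real.log_le_iff_le_exp hr).mpr hr1
  have hl0 : 0 < Real.log (1 / r) := lt_of_lt_of_le (by positivity) hl
  refine ⟨C / Real.log (1 / r), by positivity, ?_, ?_, fun y hy => ?_⟩
  · rw [div_le_iff₀ hl0]
    rw [div_le_iff₀ hd₁] at hl
    linarith
  · rw [div_mul_cancel₀ _ hl0.ne']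
  · have hxy : dist x y < r := by rw [dist_comm]; exact hy
    refine ⟨(h₁ x y r hr hlt hxy).trans ?_, (h₂ x y r hr hlt hxy).trans ?_,
      (h₃ x y r hr hlt hxy).trans ?_⟩ <;>
    · gcongr
      linarith

variable [MeasurableSpace X] {μ : Measure X}

/-- Only small radii and small measures matter: a measure above v₀ dominates v₀ r^Q trivially, and
radii between r₁ and 1 follow from r₁ by monotonicity, at the cost r₁^{Q₁}. -/
theorem lowerAhlforsRegular_of_log_bound (hμ : IsMetricMeasure μ) {Q : X → ℝ} {Q₁ A r₁ v₀ : ℝ}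
    (hQ : ∀ x, 0 ≤ Q x) (hQ₁ : ∀ x, Q x ≤ Q₁) (hr₁ : 0 < r₁) (hr₁1 : r₁ ≤ 1) (hv₀ : 0 < v₀)
    (h : ∀ (x : X) (r : ℝ), 0 < r → r ≤ r₁ → μ.real (Metric.ball x r) ≤ v₀ →
      Real.log (1 / μ.real (Metric.ball x r)) ≤ A + Q x * Real.log (1 / r)) :
    LowerAhlforsRegular μ Q := by
  set c := min v₀ (Real.exp (-A)) with hc
  have hc0 : 0 < c := lt_min hv₀ (Real.exp_pos _)
  have hsmall : ∀ (x : X) (r : ℝ), 0 < r → r ≤ r₁ → c * r ^ Q x ≤ μ.real (Metric.ball x r) := by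
    intro x r hr hr1
    have hpow : r ^ Q x ≤ 1 := Real.rpow_le_one hr.le (hr1.trans hr₁1) (hQ x)
    have hpow0 : 0 < r ^ Q x := Real.rpow_pos_of_pos hr _
    rcases le_or_gt (μ.real (Metric.ball x r)) v₀ with hv | hv
    · have hpos := hμ.real_ball_pos x hr
      have h1 := h x r hr hr1 hv
      rw [one_div, one_div, Real.log_inv, Real.log_inv] at h1
      calc c * r ^ Q x ≤ Real.exp (-A) * r ^ Q x := by gcongr; exact min_le_right _ _
        _ = Real.exp (-A + Real.log r * Q x) := by rw [Real.exp_add, Real.rpow_def_of_pos hr]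
        _ ≤ Real.exp (Real.log (μ.real (Metric.ball x r))) := by
          refine Real.exp_le_exp.mpr ?_
          linarith
        _ = _ := Real.exp_log hpos
    · calc c * r ^ Q x ≤ v₀ * 1 := by gcongr; exact min_le_left _ _
        _ ≤ _ := by linarith
  refine ⟨c * r₁ ^ Q₁, by positivity, fun x r hr hr1 => ?_⟩
  rw [← ENNReal.ofReal_toReal (hμ.measure_ball_ne_top x r)]
  refine ENNReal.ofReal_le_ofReal ?_
  change _ ≤ μ.real (Metric.ball x r)
  have hpow : r ^ Q x ≤ 1 := Real.rpow_le_one hr.le hr1 (hQ x)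
  have hpow0 : 0 < r ^ Q x := Real.rpow_pos_of_pos hr _
  rcases le_total r r₁ with hle | hle
  · refine le_trans ?_ (hsmall x r hr hle)
    gcongr
    exact mul_le_of_le_one_right hc0.le
      (Real.rpow_le_one hr₁.le hr₁1 ((hQ x).trans (hQ₁ x)))
  · calc c * r₁ ^ Q₁ * r ^ Q x ≤ c * r₁ ^ Q x * 1 := by
          gcongr ?_ * ?_
          gcongr c * ?_
          exact Real.rpow_le_rpow_of_exponent_ge hr₁ hr₁1 (hQ₁ x)
      _ = c * r₁ ^ Q x := mul_one _
      _ ≤ _ := hsmall x r₁ hr₁ le_rfl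
      _ ≤ _ := hμ.real_ball_mono x hle

/-- When the measure at most halves between t' and t, the inner measure can be replaced by the outer
one, and the inequality becomes a bound on the gap t - t' with exponent β - g. The constants depend
on a and g only through a₁ and g₁, as uniformity in the centre requires. -/
theorem rpow_le_of_closedBall_rpow_le [BorelSpace X] (hμ : IsMetricMeasure μ) (z : X)
    {ρ a a₁ g g₁ β β₀ K : ℝ} (hρ : 0 < ρ) (ha : 0 < a) (ha₁ : a ≤ a₁) (hg : 0 ≤ g) (hg₁ : g ≤ g₁)
    (hβ₀ : 0 < β₀) (hβ : β₀ ≤ β - g) (hK : 0 < K)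
    (h : ∀ t' t : ℝ, 0 ≤ t' → t' < t → t ≤ ρ →
      0 < μ.real (Metric.closedBall z t') →
      μ.real (Metric.closedBall z t') ^ g ≤
        K * ((t - t') ^ (-a) * μ.real (Metric.ball z t) ^ β)) :
    ρ ^ a ≤ K * 2 ^ g₁ * ((1 - 2 ^ (-(β₀ / a₁)))⁻¹) ^ a₁ *
      μ.real (Metric.ball z ρ) ^ (β - g) := by
  have ha₁0 : 0 < a₁ := ha.trans_le ha₁
  refine radius_rpow_le_of_gap hμ z hρ ha ha₁ (by positivity) ?_ (by positivity) ?_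
  · refine le_trans ?_ hβ
    rw [div_mul_eq_mul_div, div_le_iff₀ ha₁0]
    gcongr
  intro t' t h0 h1 h2 h3
  have hL : 0 < t - t' := by linarith
  set v := μ.real (Metric.ball z t) with hv
  have hv0 : 0 < v := hμ.real_ball_pos z (h0.trans_lt h1)
  have hw0 : 0 < μ.real (Metric.closedBall z t') := by linarith
  have h4 := h t' t h0 h1 h2 hw0
  have h5 : v ^ g ≤ 2 ^ g₁ * (K * ((t - t') ^ (-a) * v ^ β)) := by
    calc v ^ g ≤ (2 * μ.real (Metric.closedBall z t')) ^ g := by gcongr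
      _ = 2 ^ g * μ.real (Metric.closedBall z t') ^ g := Real.mul_rpow zero_le_two hw0.le
      _ ≤ 2 ^ g₁ * (K * ((t - t') ^ (-a) * v ^ β)) := by
        gcongr
        exact one_le_two
  rw [Real.rpow_neg hL.le] at h5
  rw [Real.rpow_sub hv0, mul_div_assoc', le_div_iff₀ (by positivity)]
  have h6 : 0 < (t - t') ^ a := by positivity
  calc (t - t') ^ a * v ^ g ≤ (t - t') ^ a * (2 ^ g₁ * (K * (((t - t') ^ a)⁻¹ * v ^ β))) := by gcongr
    _ = _ := by field_simp

/-- Lower bound for the distance of a bump to the constants. -/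
theorem le_iInf_lebesgueNorm_radialBump_sub {ν : Measure X} {γ : X → ℝ} (hγ : ∀ x, 0 < γ x) {z : X}
    {a b : ℝ} (hab : a < b) {F₁ F₂ : Set X} (hF₁ : MeasurableSet F₁) (hF₂ : MeasurableSet F₂)
    (hFa : F₁ ⊆ Metric.closedBall z a) (hFb : Disjoint F₂ (Metric.ball z b))
    {m₁ m₂ G₁ G₂ : ℝ} (hm₁ : 0 < m₁) (hm₂ : 0 < m₂) (hm₁1 : m₁ ≤ 1) (hm₂1 : m₂ ≤ 1)
    (hG₁ : 0 < G₁) (hG₂ : 0 < G₂) (hγ₁ : ∀ y ∈ F₁, 1 / γ y ≤ G₁) (hγ₂ : ∀ y ∈ F₂, 1 / γ y ≤ G₂)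
    (hν₁ : ENNReal.ofReal m₁ ≤ ν F₁) (hν₂ : ENNReal.ofReal m₂ ≤ ν F₂) :
    ENNReal.ofReal (1 / 2 * min (m₁ ^ G₁) (m₂ ^ G₂)) ≤
      ⨅ c : ℝ, lebesgueNorm ν γ (fun x => ENNReal.ofReal |radialBump z a b x - c|) := by
  refine le_iInf fun c => ?_
  rcases le_total (1 / 2) |c| with hc | hc
  · refine le_trans (ENNReal.ofReal_le_ofReal ?_) (mul_rpow_le_lebesgueNorm hF₂ (half_pos one_pos)
      hm₂ hG₂ (fun x _ => hγ x) hγ₂ (fun x hx => ?_) hν₂ hm₂1)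
    · gcongr
      exact min_le_right _ _
    · rw [radialBump_eq_zero hab (disjoint_left.mp hFb hx), zero_sub, abs_neg]
      exact ENNReal.ofReal_le_ofReal hc
  · refine le_trans (ENNReal.ofReal_le_ofReal ?_) (mul_rpow_le_lebesgueNorm hF₁ (half_pos one_pos)
      hm₁ hG₁ (fun x _ => hγ x) hγ₁ (fun x hx => ?_) hν₁ hm₁1)
    · gcongr
      exact min_le_left _ _
    · rw [radialBump_eq_one hab (hFa hx)]
      refine ENNReal.ofReal_le_ofReal ?_
      rw [abs_le] at hc
      rw [abs_of_nonneg (by linarith)]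
      linarith

theorem exists_gap_of_exponentGG {p γ : X → ℝ} (hμ : IsMetricMeasure μ)
    (hp : IsBddLogExponent μ p)
    (hγ : IsBddLogExponent μ γ) (hγp : ExponentGG μ γ p) :
    ∃ κ : ℝ, 0 < κ ∧ ∀ x, κ ≤ 1 / p x - 1 / γ x := by
  obtain ⟨ε, hε, h⟩ := hγp.exists_forall_le hμ hp hγ
  obtain ⟨-, P, -, hP, -, hpP⟩ := hp.exists_bounds hμ
  obtain ⟨-, Γ, -, hΓ, -, hγΓ⟩ := hγ.exists_bounds hμ
  refine ⟨ε / (P * Γ), by positivity, fun x => ?_⟩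
  have h1 := hp.1.2.1 x
  have h2 := hγ.1.2.1 x
  rw [div_sub_div _ _ h1.ne' h2.ne', one_mul, mul_one]
  exact div_le_div₀ (hε.le.trans (h x)) (h x) (by positivity)
    (mul_le_mul (hpP x) (hγΓ x) h2.le hP.le)

end LowerBounds

/-! ### Global Sobolev embeddings -/

section Global

variable {X : Type*} [MetricSpace X] [MeasurableSpace X] [BorelSpace X] {μ : Measure X}
  {p s γ : X → ℝ} {q : X → ℝ≥0∞}

theorem exists_homNorm_radialBump_le_of_admissible [Nonempty X] (hμ : IsMetricMeasure μ)
    (A : HajlaszScale) (hp : IsBddLogExponent μ p) (hs : IsBddLogExponent μ s)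
    (hq : IsExponent μ q) (hsq : SmoothnessAdmissible μ s q) :
    ∃ K : ℝ, 0 < K ∧ ∀ (z : X) (a b : ℝ), a < b → ∀ E : Set X, ∀ T : ℝ, 0 < T →
      ∫⁻ y in Metric.ball z b, ENNReal.ofReal ((b - a) ^ (-s y) / T) ^ p y ∂μ ≤ 1 →
      homNorm A μ s p q E (radialBump z a b) ≤ ENNReal.ofReal (K * T) := by
  obtain ⟨s₀, -, hs₀, -, hs₀', -⟩ := hs.exists_bounds hμ
  obtain ⟨s₁, hs₁0, hs₁, hsq'⟩ := hsq.exists_upper_bound hμ hs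
  obtain ⟨q₀, hq₀, hq₀'⟩ := hq.exists_real_lower_bound
  exact exists_homNorm_radialBump_le A hp.1.2.1 hs.1.1 hs₀ hs₀' hs₁0 hs₁ hq₀ hq₀' hsq'

/-- The estimate for radial bumps that all three global Sobolev embeddings imply. -/
def BumpEstimate (μ : Measure X) (s p γ : X → ℝ) : Prop :=
  ∃ K v₀ : ℝ, 0 < K ∧ 0 < v₀ ∧ v₀ ≤ 1 ∧ ∀ (z : X) (a b : ℝ), 0 ≤ a → a < b → b ≤ 1 →
    μ.real (Metric.ball z b) ≤ v₀ → 0 < μ.real (Metric.closedBall z a) → ∀ T : ℝ, 0 < T →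
    ∫⁻ y in Metric.ball z b, ENNReal.ofReal ((b - a) ^ (-s y) / T) ^ p y ∂μ ≤ 1 →
    ∀ G : ℝ, 0 < G → (∀ y ∈ Metric.ball z b, 1 / γ y ≤ G) →
      μ.real (Metric.closedBall z a) ^ G ≤ K * T

theorem rpow_le_lebesgueNorm_radialBump (hμ : IsMetricMeasure μ) (hγ : ∀ x, 0 < γ x) {z : X}
    {a b G : ℝ} (hab : a < b) (hb : μ.real (Metric.ball z b) ≤ 1)
    (ha : 0 < μ.real (Metric.closedBall z a)) (hG : 0 < G)
    (hγG : ∀ y ∈ Metric.ball z b, 1 / γ y ≤ G) :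
    ENNReal.ofReal (μ.real (Metric.closedBall z a) ^ G) ≤
      lebesgueNorm μ γ (fun x => ENNReal.ofReal |radialBump z a b x|) := by
  rw [← one_mul (μ.real (Metric.closedBall z a) ^ G)]
  refine mul_rpow_le_lebesgueNorm Metric.isClosed_closedBall.measurableSet one_pos ha hG
    (fun x _ => hγ x) (fun x hx => hγG x (Metric.closedBall_subset_ball hab hx)) (fun x hx => ?_)
    (hμ.ofReal_real_closedBall z a).le ((hμ.real_closedBall_le z hab).trans hb)
  rw [radialBump_eq_one hab hx, abs_one]

theorem bumpEstimate_of_homEmbedsLebesgue [Nonempty X] (hμ : IsMetricMeasure μ)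
    {A : HajlaszScale} (hp : IsBddLogExponent μ p) (hs : IsBddLogExponent μ s)
    (hq : IsExponent μ q) (hsq : SmoothnessAdmissible μ s q) (hγ : IsBddLogExponent μ γ)
    (h : HomEmbedsLebesgue A μ s p q γ) : BumpEstimate μ s p γ := by
  obtain ⟨K, hK, hbump⟩ := exists_homNorm_radialBump_le_of_admissible hμ A hp hs hq hsq
  obtain ⟨C, hC, h⟩ := h
  refine ⟨C * K, 1, by positivity, one_pos, le_rfl, ?_⟩
  intro z a b h0 hab hb1 hv hw T hT hmod G hG hγG
  have h1 := hbump z a b hab univ T hT hmod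
  have h2 := h _ ⟨(continuous_radialBump z a b).measurable, h1.trans_lt ENNReal.ofReal_lt_top⟩
  have h3 := (rpow_le_lebesgueNorm_radialBump hμ hγ.1.2.1 hab hv hw hG hγG).trans
    (h2.trans (mul_le_mul_right h1 _))
  rw [← ENNReal.ofReal_mul hC.le, ENNReal.ofReal_le_ofReal_iff (by positivity)] at h3
  linarith

theorem bumpEstimate_of_inhomEmbedsLebesgue [Nonempty X] (hμ : IsMetricMeasure μ)
    {A : HajlaszScale} (hp : IsBddLogExponent μ p) (hs : IsBddLogExponent μ s)
    (hq : IsExponent μ q) (hsq : SmoothnessAdmissible μ s q) (hγ : IsBddLogExponent μ γ)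
    (h : InhomEmbedsLebesgue A μ s p q γ) : BumpEstimate μ s p γ := by
  obtain ⟨K, hK, hbump⟩ := exists_homNorm_radialBump_le_of_admissible hμ A hp hs hq hsq
  obtain ⟨C, hC, h⟩ := h
  refine ⟨C * (1 + K), 1, by positivity, one_pos, le_rfl, ?_⟩
  intro z a b h0 hab hb1 hv hw T hT hmod G hG hγG
  have hL : 0 < b - a := by linarith
  have h1 := hbump z a b hab univ T hT hmod
  have hnorm : lebesgueNorm μ p (fun x => ENNReal.ofReal |radialBump z a b x|) ≤
      ENNReal.ofReal T := by
    refine lebesgueNorm_le (by positivity) ENNReal.ofReal_lt_top (le_trans ?_ hmod)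
    have h4 := lebesgueModular_smul_indicator_div (ν := μ) hp.1.2.1
      (Metric.isOpen_ball (x := z) (ε := b)).measurableSet (f := fun y => (b - a) ^ (-s y))
      one_pos hT
    rw [← h4]
    refine lebesgueModular_mono_ae hp.1.2.1 (Filter.Eventually.of_forall fun y => ?_)
    rw [one_mul]
    gcongr
    by_cases hy : y ∈ Metric.ball z b
    · rw [indicator_of_mem hy, one_mul, abs_of_nonneg (radialBump_nonneg ..)]
      refine ENNReal.ofReal_le_ofReal ((radialBump_le_one z a b y).trans ?_)
      -- Here b ≤ 1 enters: L ≤ 1 gives 1 ≤ L^{-s}, so the L^p norm of the bump is also at most T.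
      exact Real.one_le_rpow_of_pos_of_le_one_of_nonpos hL (by linarith)
        (by linarith [hs.1.2.1 y])
    · rw [radialBump_eq_zero hab hy, abs_zero, ENNReal.ofReal_zero]
      exact zero_le
  have hinh : inhomNorm A μ s p q (radialBump z a b) ≤ ENNReal.ofReal (T + K * T) := by
    rw [ENNReal.ofReal_add hT.le (by positivity)]
    exact add_le_add hnorm h1
  have h2 := h _ (continuous_radialBump z a b).measurable (hinh.trans_lt ENNReal.ofReal_lt_top)
  have h3 := (rpow_le_lebesgueNorm_radialBump hμ hγ.1.2.1 hab hv hw hG hγG).trans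
    (h2.trans (mul_le_mul_right hinh _))
  rw [← ENNReal.ofReal_mul hC.le, ENNReal.ofReal_le_ofReal_iff (by positivity)] at h3
  linarith

/-- Off the support of a bump in a ball of small measure a fixed amount of mass remains: infinite
mass, or at least half of a finite total. It excludes approximation of the bump by constants far
from 0. -/
theorem exists_ofReal_le_measure_compl_ball [Nonempty X] (hμ : IsMetricMeasure μ) :
    ∃ m : ℝ, 0 < m ∧ m ≤ 1 ∧ ∀ (z : X) (b : ℝ), μ.real (Metric.ball z b) ≤ m →
      ENNReal.ofReal m ≤ μ (Metric.ball z b)ᶜ := by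
  obtain ⟨x₀⟩ := ‹Nonempty X›
  rcases eq_or_ne (μ univ) ∞ with htop | hfin
  · refine ⟨1, one_pos, le_rfl, fun z b _ => ?_⟩
    rw [measure_compl Metric.isOpen_ball.measurableSet (hμ.measure_ball_ne_top z b), htop,
      ENNReal.top_sub (hμ.measure_ball_ne_top z b)]
    exact le_top
  · have hpos : 0 < μ.real univ := (hμ.real_ball_pos x₀ one_pos).trans_le
      (measureReal_mono (subset_univ _) hfin)
    refine ⟨min 1 (μ.real univ / 2), by positivity, min_le_left _ _, fun z b hb => ?_⟩
    have h1 : μ.real (Metric.ball z b)ᶜ = μ.real univ - μ.real (Metric.ball z b) := by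
      have : IsFiniteMeasure μ := ⟨lt_top_iff_ne_top.mpr hfin⟩
      exact measureReal_compl Metric.isOpen_ball.measurableSet
    have h2 : μ (Metric.ball z b)ᶜ ≠ ∞ := measure_ne_top_of_subset (subset_univ _) hfin
    rw [← ENNReal.ofReal_toReal h2]
    refine ENNReal.ofReal_le_ofReal ?_
    change _ ≤ μ.real _
    rw [h1]
    have := min_le_right 1 (μ.real univ / 2)
    linarith

theorem bumpEstimate_of_homEmbedsLebesgueModConst [Nonempty X] (hμ : IsMetricMeasure μ)
    {A : HajlaszScale} (hp : IsBddLogExponent μ p) (hs : IsBddLogExponent μ s)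
    (hq : IsExponent μ q) (hsq : SmoothnessAdmissible μ s q) (hγ : IsBddLogExponent μ γ)
    (h : HomEmbedsLebesgueModConst A μ s p q γ) : BumpEstimate μ s p γ := by
  obtain ⟨K, hK, hbump⟩ := exists_homNorm_radialBump_le_of_admissible hμ A hp hs hq hsq
  obtain ⟨γ₀, -, hγ₀, -, hγ₀', -⟩ := hγ.exists_bounds hμ
  obtain ⟨m, hm, hm1, hcompl⟩ := exists_ofReal_le_measure_compl_ball hμ
  obtain ⟨C, hC, h⟩ := h
  set M := m ^ (1 / γ₀) with hM
  have hM0 : 0 < M := by positivity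
  have hM1 : M ≤ 1 := Real.rpow_le_one hm.le hm1 (by positivity)
  refine ⟨2 / M * (C * K), m, by positivity, hm, hm1, ?_⟩
  intro z a b h0 hab hb1 hv hw T hT hmod G hG hγG
  have h1 := hbump z a b hab univ T hT hmod
  have h2 := h _ ⟨(continuous_radialBump z a b).measurable, h1.trans_lt ENNReal.ofReal_lt_top⟩
  set w := μ.real (Metric.closedBall z a) with hw'
  have hw1 : w ≤ 1 := (hμ.real_closedBall_le z hab).trans (hv.trans hm1)
  have h3 := (le_iInf_lebesgueNorm_radialBump_sub (ν := μ) hγ.1.2.1 hab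
    Metric.isClosed_closedBall.measurableSet Metric.isOpen_ball.measurableSet.compl
    Subset.rfl disjoint_compl_left hw hm hw1 hm1 hG (one_div_pos.mpr hγ₀)
    (fun y hy => hγG y (Metric.closedBall_subset_ball hab hy))
    (fun y _ => one_div_le_one_div_of_le hγ₀ (hγ₀' y)) (hμ.ofReal_real_closedBall z a).le
    (hcompl z b hv)).trans (h2.trans (mul_le_mul_right h1 _))
  rw [← ENNReal.ofReal_mul hC.le, ENNReal.ofReal_le_ofReal_iff (by positivity)] at h3
  have hwG : w ^ G ≤ 1 := Real.rpow_le_one hw.le hw1 hG.le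
  have hwG0 : 0 < w ^ G := by positivity
  -- Both factors are at most 1, so their product is below each of them and the minimum costs only
  -- the constant M.
  have h4 : M * w ^ G ≤ min (w ^ G) M :=
    le_min (mul_le_of_le_one_left hwG0.le hM1) (mul_le_of_le_one_right hM0.le hwG)
  rw [div_mul_eq_mul_div, div_mul_eq_mul_div, le_div_iff₀ hM0]
  linarith

theorem sobolev_exponent_eq {a b c : ℝ} (hb : 0 < b) (hc : 0 < c) (h : 0 < 1 / b - 1 / c) :
    c * a * b / (c - b) = a / (1 / b - 1 / c) := by
  have h1 : 1 / b - 1 / c = (c - b) / (b * c) := by field_simp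
  rw [h1] at h ⊢
  have h2 : c - b ≠ 0 := by
    intro h0
    rw [h0, zero_div] at h
    exact lt_irrefl _ h
  field_simp

theorem lowerAhlforsRegular_of_bumpEstimate (hμ : IsMetricMeasure μ)
    (hp : IsBddLogExponent μ p) (hs : IsBddLogExponent μ s)
    (hγ : IsBddLogExponent μ γ) (hγp : ExponentGG μ γ p) (h : BumpEstimate μ s p γ) :
    LowerAhlforsRegular μ (fun x => γ x * s x * p x / (γ x - p x)) := by
  obtain ⟨κ, hκ, hgap⟩ := exists_gap_of_exponentGG hμ hp hγ hγp
  obtain ⟨s₀, s₁, hs₀, hs₁, hs₀', hs₁'⟩ := hs.exists_bounds hμ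
  obtain ⟨γ₀, -, hγ₀, -, hγ₀', -⟩ := hγ.exists_bounds hμ
  obtain ⟨K, v₀, hK, hv₀, hv₀1, h⟩ := h
  -- An oscillation d ≤ κ/4 keeps the perturbed exponent (1/p - d) - (1/γ + d) at least κ/2.
  obtain ⟨C, r₁, hC, hr₁, hr₁1, hosc⟩ := exists_uniform_oscillation (d₁ := κ / 4) (by positivity)
    (hs.exists_abs_sub_le hμ) hp.2.exists_abs_sub_le hγ.2.exists_abs_sub_le
  have hQ : (fun x => γ x * s x * p x / (γ x - p x)) = fun x => s x / (1 / p x - 1 / γ x) :=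
    funext fun x => sobolev_exponent_eq (hp.1.2.1 x) (hγ.1.2.1 x) (hκ.trans_le (hgap x))
  rw [hQ]
  set a₁ := s₁ + κ / 4 with ha₁
  set D := K * 2 ^ (1 / γ₀ + κ / 4) * ((1 - 2 ^ (-(κ / 2 / a₁)))⁻¹) ^ a₁ with hD
  set A := |Real.log D| with hA
  set A' := A + C + 4 / κ * (κ / 4 * A + s₁ * C + κ / 4 * C) with hA'
  have hA'0 : 0 ≤ A' := by positivity
  refine lowerAhlforsRegular_of_log_bound hμ (Q₁ := s₁ / κ) (A := A' / κ) (r₁ := r₁) (v₀ := v₀)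
    (fun x => ?_) (fun x => ?_) hr₁ hr₁1.le hv₀ ?_
  · have := hgap x
    have := hs.1.2.1 x
    exact div_nonneg this.le (by linarith)
  · have := hgap x
    gcongr
    exact hs₁' x
  intro x r hr hr1 hv
  obtain ⟨d, hd0, hd1, hdl, hball⟩ := hosc x r hr hr1
  have hB := hgap x
  have hpx := hp.1.2.1 x
  have hγx := hγ.1.2.1 x
  have hsx := hs.1.2.1 x
  have hγx' : 1 / γ x ≤ 1 / γ₀ := one_div_le_one_div_of_le hγ₀ (hγ₀' x)
  have hγxp : 0 < 1 / γ x := by positivity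
  have hb : ∀ y ∈ Metric.ball x r, s y ≤ s x + d ∧ 1 / p x - d ≤ 1 / p y ∧
      1 / γ y ≤ 1 / γ x + d := by
    intro y hy
    obtain ⟨h1, h2, h3⟩ := hball y hy
    rw [abs_le] at h1 h2 h3
    refine ⟨?_, ?_, ?_⟩ <;> linarith
  have hvpos := hμ.real_ball_pos x hr
  have hkey := rpow_le_of_closedBall_rpow_le hμ x (ρ := r) (a := s x + d) (a₁ := a₁)
    (g := 1 / γ x + d) (g₁ := 1 / γ₀ + κ / 4) (β := 1 / p x - d) (β₀ := κ / 2) (K := K) hr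
    (by linarith) (by linarith [hs₁' x]) (by linarith) (by linarith) (by positivity)
    (by linarith) hK (by
      intro t' t h0 h1 h2 hw
      have htr : Metric.ball x t ⊆ Metric.ball x r := Metric.ball_subset_ball h2
      have hL : 0 < t - t' := by linarith
      have hvt := hμ.real_ball_mono x h2
      have hvt0 := hμ.real_ball_pos x (h0.trans_lt h1)
      refine h x t' t h0 h1 (by linarith) (hvt.trans hv) hw _ (by positivity) ?_ _ (by linarith)
        fun y hy => (hb y (htr hy)).2.2
      exact lintegral_rpow_div_le_one hp.1.2.1 Metric.isOpen_ball.measurableSet hL (by linarith)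
        (fun y hy => (hb y (htr hy)).1) (fun y hy => (hb y (htr hy)).2.1) hvt0
        (hvt.trans (hv.trans hv₀1)) (hμ.ofReal_real_ball x t).ge)
  rw [← hD] at hkey
  have hDpos : 0 < D := by
    have : (2 : ℝ) ^ (-(κ / 2 / a₁)) < 1 :=
      Real.rpow_lt_one_of_one_lt_of_neg one_lt_two (by rw [neg_lt_zero]; positivity)
    have h2 : 0 < 1 - (2 : ℝ) ^ (-(κ / 2 / a₁)) := by linarith
    positivity
  have hlog := Real.log_le_log (by positivity) hkey
  rw [Real.log_rpow hr, Real.log_mul hDpos.ne' (by positivity), Real.log_rpow hvpos] at hlog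
  set m := Real.log (1 / μ.real (Metric.ball x r)) with hm
  set l := Real.log (1 / r) with hl
  have hm' : Real.log (μ.real (Metric.ball x r)) = -m := by
    rw [hm, one_div, Real.log_inv, neg_neg]
  have hl' : Real.log r = -l := by rw [hl, one_div, Real.log_inv, neg_neg]
  have hm0 : 0 ≤ m := by
    have := Real.log_nonpos hvpos.le (hv.trans hv₀1)
    linarith
  have hl0 : 0 ≤ l := by
    have := Real.log_nonpos hr.le (hr1.trans hr₁1.le)
    linarith
  rw [hm', hl'] at hlog
  have hfin := absorb_log_error (W := 0) (B := 1 / p x - 1 / γ x) (d := d) (m := m) (A := A)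
    (S := s x) (S₁ := s₁) (l := l) (κ := κ) (C := C) (d₁ := κ / 4) le_rfl hκ hB hd0 (by linarith)
    hd1 hm0 hdl hl0 (abs_nonneg _) (hs₁' x) hs₁.le (by
      have := le_abs_self (Real.log D)
      linarith)
  rw [← hA', zero_add] at hfin
  have hBpos : 0 < 1 / p x - 1 / γ x := hκ.trans_le hB
  have h1 : m ≤ (A' + s x * l) / (1 / p x - 1 / γ x) := by
    rw [le_div_iff₀ hBpos]; linarith
  refine h1.trans ?_
  rw [add_div, mul_comm (s x) l, mul_div_assoc, mul_comm l]
  gcongr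

end Global

/-! ### Functions with vanishing homogeneous quasi-norm -/

section Vanishing

variable {X : Type*} [MetricSpace X] [MeasurableSpace X] {μ : Measure X}
  {p s : X → ℝ} {q : X → ℝ≥0∞}

/-- Modulars of size 2^{-n} are summable in n, which yields pointwise convergence without passing to
subsequences. θ is chosen with θ^{p₀} = 2^{-n}, and D offsets the factor 2^{1/q₀} of the entrywise
bound. -/
theorem exists_gradient_lintegral_le {A : HajlaszScale} (hp : ∀ x, 0 < p x)
    {p₀ q₀ : ℝ} (hp₀ : 0 < p₀) (hp₀' : ∀ x, p₀ ≤ p x) (hq₀ : 0 < q₀)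
    (hq : ∀ᵐ x ∂μ, ENNReal.ofReal q₀ ≤ q x) {E : Set X} {u : X → ℝ}
    (h : homNorm A μ s p q E u = 0) (n : ℕ) :
    ∃ g : ℤ → X → ℝ≥0∞, IsVectorGradient μ s E u g ∧
      ∀ k, ∫⁻ x in E, g k x ^ p x ∂μ ≤ 2⁻¹ ^ n := by
  set θ : ℝ≥0∞ := (2⁻¹ ^ n) ^ p₀⁻¹ with hθ
  have hpow0 : (2⁻¹ : ℝ≥0∞) ^ n ≠ 0 := by simp
  have hpow1 : (2⁻¹ : ℝ≥0∞) ^ n ≤ 1 := pow_le_one₀ zero_le (by simp)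
  have hpowt : (2⁻¹ : ℝ≥0∞) ^ n ≠ ∞ := (hpow1.trans_lt ENNReal.one_lt_top).ne
  have hθ0 : 0 < θ := ENNReal.rpow_pos (pos_iff_ne_zero.mpr hpow0) hpowt
  have hθ1 : θ ≤ 1 := ENNReal.rpow_le_one hpow1 (by positivity)
  have hθt : θ ≠ ∞ := (hθ1.trans_lt ENNReal.one_lt_top).ne
  have hθp : θ ^ p₀ = 2⁻¹ ^ n := by
    rw [hθ, ← ENNReal.rpow_mul, inv_mul_cancel₀ hp₀.ne', ENNReal.rpow_one]
  set D : ℝ≥0∞ := 2 ^ q₀⁻¹ with hD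
  have hDt : D ≠ ∞ := ENNReal.rpow_ne_top_of_nonneg (by positivity) (by simp)
  have hD0 : D ≠ 0 := (ENNReal.rpow_pos two_pos (by simp)).ne'
  have hlt : homNorm A μ s p q E u < θ / D := by
    rw [h]; exact ENNReal.div_pos hθ0.ne' hDt
  rw [homNorm, iInf_lt_iff] at hlt
  obtain ⟨g, hlt⟩ := hlt
  rw [iInf_lt_iff] at hlt
  obtain ⟨hg, hlt⟩ := hlt
  refine ⟨g, hg, fun k => ?_⟩
  have h1 := lebesgueModular_div_le_one_of_gradientNorm_lt A hp hq₀ (ae_restrict_of_ae hq) hlt k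
  rw [← hD, ENNReal.div_mul_cancel hD0 hDt] at h1
  calc ∫⁻ x in E, g k x ^ p x ∂μ
      ≤ ∫⁻ x in E, 2⁻¹ ^ n * (g k x / θ) ^ p x ∂μ := by
        refine lintegral_mono fun x => ?_
        calc g k x ^ p x = θ ^ p x * (g k x / θ) ^ p x := by
              rw [← ENNReal.mul_rpow_of_nonneg _ _ (hp x).le, ENNReal.mul_div_cancel hθ0.ne' hθt]
          _ ≤ _ := by
              rw [← hθp]
              exact mul_le_mul' (ENNReal.rpow_le_rpow_of_exponent_ge hθ1 (hp₀' x)) le_rfl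
    _ = 2⁻¹ ^ n * ∫⁻ x in E, (g k x / θ) ^ p x ∂μ := lintegral_const_mul' _ _ hpowt
    _ ≤ 2⁻¹ ^ n * 1 := mul_le_mul' le_rfl h1
    _ = _ := mul_one _

/-- Gradients with summable modulars tend to 0 almost everywhere, and the gradient inequality passes
to the limit at each pair of points off a null set. -/
theorem eq_off_null_of_homNorm_eq_zero {A : HajlaszScale} (hpm : Measurable p)
    {p₀ q₀ : ℝ} (hp₀ : 0 < p₀) (hp₀' : ∀ x, p₀ ≤ p x) (hq₀ : 0 < q₀)
    (hq : ∀ᵐ x ∂μ, ENNReal.ofReal q₀ ≤ q x) {E : Set X} (hE : MeasurableSet E) {u : X → ℝ}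
    (h : homNorm A μ s p q E u = 0) :
    ∃ N : Set X, μ N = 0 ∧ ∀ x ∈ E \ N, ∀ y ∈ E \ N, u x = u y := by
  have hp : ∀ x, 0 < p x := fun x => hp₀.trans_le (hp₀' x)
  choose g hg hgint using exists_gradient_lintegral_le hp hp₀ hp₀' hq₀ hq h
  choose N hN hgN using fun n => (hg n).2
  have hlim : ∀ᵐ x ∂μ, x ∈ E → ∀ k, Filter.Tendsto (fun n => g n k x) Filter.atTop (nhds 0) := by
    rw [← ae_restrict_iff' hE, ae_all_iff]
    intro k
    have hmeas : ∀ n, Measurable fun x => g n k x ^ p x := fun n => ((hg n).1 k).pow hpm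
    have hfin : ∫⁻ x in E, ∑' n, g n k x ^ p x ∂μ ≠ ∞ := by
      rw [lintegral_tsum fun n => (hmeas n).aemeasurable]
      refine ne_top_of_le_ne_top ?_ (ENNReal.tsum_le_tsum fun n => hgint n k)
      rw [ENNReal.tsum_geometric]
      simp
    filter_upwards [ae_lt_top' (Measurable.tsum hmeas).aemeasurable hfin] with x hx
    have h1 := ENNReal.tendsto_atTop_zero_of_tsum_ne_top hx.ne
    have h2 := (ENNReal.continuous_rpow_const (y := (p x)⁻¹)).tendsto 0 |>.comp h1
    have hpx := hp x
    rw [ENNReal.zero_rpow_of_pos (by positivity)] at h2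
    refine h2.congr fun n => ?_
    rw [Function.comp_apply, ← ENNReal.rpow_mul, mul_inv_cancel₀ hpx.ne', ENNReal.rpow_one]
  refine ⟨(⋃ n, N n) ∪ {x | ¬ (x ∈ E →
    ∀ k, Filter.Tendsto (fun n => g n k x) Filter.atTop (nhds 0))},
    measure_union_null (measure_iUnion_null hN) hlim, ?_⟩
  rintro x ⟨hxE, hx⟩ y ⟨hyE, hy⟩
  simp only [mem_union, mem_iUnion, mem_ofPred_eq, not_or, not_exists, not_not] at hx hy
  rcases eq_or_ne x y with rfl | hne
  · rfl
  obtain ⟨n, hn1, hn2⟩ := exists_mem_Ico_zpow (dist_pos.mpr hne) (one_lt_two (α := ℝ))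
  -- For dist x y in [2^n, 2^{n+1}) the relevant entry of the gradient is k = -n-1.
  have hx' := hx.2 hxE (-n - 1)
  have hy' := hy.2 hyE (-n - 1)
  have hle : ∀ i, ENNReal.ofReal |u x - u y| ≤ ENNReal.ofReal (dist x y ^ s x) * g i (-n - 1) x +
      ENNReal.ofReal (dist x y ^ s y) * g i (-n - 1) y := by
    intro i
    refine hgN i (-n - 1) x ⟨hxE, hx.1 i⟩ y ⟨hyE, hy.1 i⟩ ?_ ?_
    · rwa [show -(-n - 1) - 1 = n by ring]
    · rwa [show -(-n - 1) = n + 1 by ring]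
  have hsum := (ENNReal.Tendsto.const_mul hx'
    (Or.inr (ENNReal.ofReal_ne_top (r := dist x y ^ s x)))).add
    (ENNReal.Tendsto.const_mul hy'
      (Or.inr (ENNReal.ofReal_ne_top (r := dist x y ^ s y))))
  have h0 := ge_of_tendsto' hsum hle
  rw [mul_zero, mul_zero, add_zero, nonpos_iff_eq_zero, ENNReal.ofReal_eq_zero] at h0
  exact sub_eq_zero.mp (abs_nonpos_iff.mp h0)

/-- The Moser–Trudinger hypothesis concerns only functions of positive quasi-norm. A bump takes the
values 1 and 0 on sets of positive measure in E, so it qualifies. -/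
theorem homNorm_radialBump_pos {A : HajlaszScale} (hpm : Measurable p)
    {p₀ q₀ : ℝ} (hp₀ : 0 < p₀) (hp₀' : ∀ x, p₀ ≤ p x) (hq₀ : 0 < q₀)
    (hq : ∀ᵐ x ∂μ, ENNReal.ofReal q₀ ≤ q x) {E F : Set X} (hE : MeasurableSet E)
    {z : X} {a b : ℝ} (hab : a < b) (hFE : F ⊆ E) (haE : Metric.closedBall z a ⊆ E)
    (hF : 0 < μ F) (ha : 0 < μ (Metric.closedBall z a)) (hFb : Disjoint F (Metric.ball z b)) :
    0 < homNorm A μ s p q E (radialBump z a b) := by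
  rw [pos_iff_ne_zero]
  intro h
  obtain ⟨N, hN, hu⟩ := eq_off_null_of_homNorm_eq_zero hpm hp₀ hp₀' hq₀ hq hE h
  have hdiff : ∀ G : Set X, 0 < μ G → (G \ N).Nonempty := fun G hG =>
    nonempty_of_measure_ne_zero (by rw [measure_sdiff_null hN]; exact hG.ne')
  obtain ⟨x, hx, hxN⟩ := hdiff _ ha
  obtain ⟨y, hy, hyN⟩ := hdiff _ hF
  have := hu x ⟨haE hx, hxN⟩ y ⟨hFE hy, hyN⟩
  rw [radialBump_eq_one hab hx, radialBump_eq_zero hab (disjoint_left.mp hFb hy)] at this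
  exact one_ne_zero this

end Vanishing

/-! ### Uniformly perfect spaces -/

section UniformlyPerfect

variable {X : Type*} [MetricSpace X]

theorem exists_compl_ball_nonempty [Nontrivial X] :
    ∃ r₀ : ℝ, 0 < r₀ ∧ ∀ (x : X) (r : ℝ), r ≤ r₀ → ((Metric.ball x r)ᶜ).Nonempty := by
  obtain ⟨a, b, hab⟩ := exists_pair_ne X
  refine ⟨dist a b / 2, half_pos (dist_pos.mpr hab), fun x r hr => ?_⟩
  by_contra hne
  rw [not_nonempty_iff_eq_empty, compl_empty_iff] at hne
  have h1 : dist a x < r := by rw [← Metric.mem_ball, hne]; trivial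
  have h2 : dist b x < r := by rw [← Metric.mem_ball, hne]; trivial
  linarith [dist_triangle_right a b x]

variable [MeasurableSpace X] {μ : Measure X}

theorem lowerAhlforsRegular_of_subsingleton [Subsingleton X] (hμ : IsMetricMeasure μ)
    {Q : X → ℝ} (hQ : ∀ x, 0 ≤ Q x) : LowerAhlforsRegular μ Q := by
  rcases isEmpty_or_nonempty X with hX | ⟨⟨x₀⟩⟩
  · exact ⟨1, one_pos, fun x => hX.elim x⟩
  · refine ⟨μ.real (Metric.ball x₀ 1), hμ.real_ball_pos x₀ one_pos, fun x r hr hr1 => ?_⟩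
    have h1 : Metric.ball x r = Metric.ball x₀ 1 := by
      ext y
      simp [Subsingleton.elim y x, Subsingleton.elim x₀ x, hr]
    rw [h1, ← hμ.ofReal_real_ball]
    exact ENNReal.ofReal_le_ofReal (mul_le_of_le_one_right measureReal_nonneg
      (Real.rpow_le_one hr.le hr1 (hQ x)))

/-- Uniform perfectness at radius r/2 gives y with λr/2 ≤ d(x,y) < r/2, so balls of radius λr/4
about x and y are disjoint and lie in B(x,r). Naming z the centre of the lighter one replaces any
doubling condition: the zero set of a bump in it has at least the mass of its plateau. -/
theorem exists_disjoint_balls {l : ℝ} (hl1 : l < 1)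
    (h : ∀ (x : X) (r : ℝ), 0 < r → ((Metric.ball x r)ᶜ).Nonempty →
      (Metric.ball x r \ Metric.ball x (l * r)).Nonempty)
    (x : X) {r : ℝ} (hr : 0 < r) (hne : ((Metric.ball x (r / 2))ᶜ).Nonempty) :
    ∃ z z' : X, Metric.ball z (l * r / 4) ⊆ Metric.ball x r ∧
      Metric.ball z' (l * r / 4) ⊆ Metric.ball x r ∧
      Disjoint (Metric.ball z' (l * r / 4)) (Metric.ball z (l * r / 4)) ∧
      μ.real (Metric.ball z (l * r / 4)) ≤ μ.real (Metric.ball z' (l * r / 4)) := by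
  obtain ⟨y, hy1, hy2⟩ := h x (r / 2) (half_pos hr) hne
  rw [Metric.mem_ball] at hy1
  rw [Metric.mem_ball, not_lt] at hy2
  have hlr : l * r < r := mul_lt_of_lt_one_left hr hl1
  have hx : Metric.ball x (l * r / 4) ⊆ Metric.ball x r := Metric.ball_subset_ball (by linarith)
  have hy : Metric.ball y (l * r / 4) ⊆ Metric.ball x r :=
    Metric.ball_subset_ball' (by linarith)
  have hd : Disjoint (Metric.ball x (l * r / 4)) (Metric.ball y (l * r / 4)) :=
    Metric.ball_disjoint_ball (by rw [dist_comm]; linarith)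
  rcases le_total (μ.real (Metric.ball x (l * r / 4))) (μ.real (Metric.ball y (l * r / 4)))
    with hle | hle
  · exact ⟨x, y, hx, hy, hd.symm, hle⟩
  · exact ⟨y, x, hy, hx, hd, hle⟩

end UniformlyPerfect

/-! ### Local Sobolev inequalities -/

section Local

variable {X : Type*} [MetricSpace X] [MeasurableSpace X] [BorelSpace X] {μ : Measure X}
  {p s γ : X → ℝ} {q : X → ℝ≥0∞}

theorem lowerAhlforsRegular_of_local_sobolev [Nontrivial X] (hμ : IsMetricMeasure μ)
    (hX : UniformlyPerfect X) {A : HajlaszScale} {σ : ℝ} (hσ : 1 ≤ σ)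
    (hp : IsBddLogExponent μ p) (hs : IsBddLogExponent μ s)
    (hq : IsExponent μ q) (hsq : SmoothnessAdmissible μ s q)
    (hγ : IsBddLogExponent μ γ) (hγp : ExponentGG μ γ p)
    {Q : X → ℝ} (hQ : ∀ x, Q x = s x / (1 / p x - 1 / γ x))
    {C₀ ω : ℝ} (hC₀ : 0 < C₀) (hω : 0 < ω)
    (h : ∀ (x₀ : X) (r₀ : ℝ), 0 < r₀ → r₀ ≤ 1 / σ →
      ∀ u : X → ℝ, MemHom A μ s p q (Metric.ball x₀ (σ * r₀)) u →
        (⨅ c : ℝ, lebesgueNorm (μ.restrict (Metric.ball x₀ r₀)) γ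
            (fun x => ENNReal.ofReal |u x - c|)) ≤
          ENNReal.ofReal C₀ * (μ (Metric.ball x₀ r₀) / ENNReal.ofReal (r₀ ^ Q x₀)) ^ ω *
            homNorm A μ s p q (Metric.ball x₀ (σ * r₀)) u) :
    LowerAhlforsRegular μ Q := by
  obtain ⟨lam, hlam0, hlam1, hperf⟩ := hX
  obtain ⟨K, hK, hbump⟩ := exists_homNorm_radialBump_le_of_admissible hμ A hp hs hq hsq
  obtain ⟨R₀, hR₀, hcompl⟩ := exists_compl_ball_nonempty (X := X)
  obtain ⟨κ, hκ, hgap⟩ := exists_gap_of_exponentGG hμ hp hγ hγp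
  obtain ⟨s₀, s₁, hs₀, hs₁, hs₀', hs₁'⟩ := hs.exists_bounds hμ
  obtain ⟨γ₀, -, hγ₀, -, hγ₀', -⟩ := hγ.exists_bounds hμ
  obtain ⟨C, r₁, hC, hr₁, hr₁1, hosc⟩ := exists_uniform_oscillation (d₁ := κ / 4) (by positivity)
    (hs.exists_abs_sub_le hμ) hp.2.exists_abs_sub_le hγ.2.exists_abs_sub_le
  have hσ0 : 0 < σ := by linarith
  set a₁ := s₁ + κ / 4 with ha₁
  set D := 2 * C₀ * K * 2 ^ (1 / γ₀ + κ / 4) * ((1 - 2 ^ (-(κ / 2 / a₁)))⁻¹) ^ a₁ with hD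
  -- The iteration runs in a ball of radius ρ = λr/4, so log(1/ρ) = log(1/r) + c₀.
  set c₀ := Real.log (4 / lam) with hc₀
  have hc₀0 : 0 < c₀ := Real.log_pos (by rw [lt_div_iff₀ hlam0]; linarith)
  set M := |Real.log D| + a₁ * c₀ with hM
  have hM0 : 0 ≤ M := by positivity
  set M' := M + C + 4 / κ * (κ / 4 * M + s₁ * C + κ / 4 * C) with hM'
  have hM'0 : 0 ≤ M' := by positivity
  set R := min r₁ (min R₀ (1 / σ)) with hR
  have hQ0 : ∀ x, 0 ≤ Q x := fun x => by
    have := hgap x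
    have := hs.1.2.1 x
    rw [hQ]
    exact div_nonneg this.le (by linarith)
  refine lowerAhlforsRegular_of_log_bound hμ (Q₁ := s₁ / κ) (A := M' / κ) (r₁ := R) (v₀ := 1)
    hQ0 (fun x => ?_) (by positivity) ((min_le_left _ _).trans hr₁1.le) one_pos ?_
  · have := hgap x
    rw [hQ]
    gcongr
    exact hs₁' x
  intro x r hr hrR hv
  have hr1 : r ≤ r₁ := hrR.trans (min_le_left _ _)
  have hrR₀ : r ≤ R₀ := hrR.trans ((min_le_right _ _).trans (min_le_left _ _))
  have hrσ : r ≤ 1 / σ := hrR.trans ((min_le_right _ _).trans (min_le_right _ _))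
  obtain ⟨d, hd0, hd1, hdl, hball⟩ := hosc x r hr hr1
  obtain ⟨z, z', hz, hz', hdisj, hzz'⟩ := exists_disjoint_balls (μ := μ) hlam1 hperf x hr
    (hcompl x (r / 2) (by linarith))
  set ρ := lam * r / 4 with hρ
  have hρ0 : 0 < ρ := by positivity
  have hρr : ρ ≤ r := by rw [hρ]; nlinarith
  have hB := hgap x
  have hpx := hp.1.2.1 x
  have hγx := hγ.1.2.1 x
  have hsx := hs.1.2.1 x
  have hγx' : 1 / γ x ≤ 1 / γ₀ := one_div_le_one_div_of_le hγ₀ (hγ₀' x)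
  have hγxp : 0 < 1 / γ x := by positivity
  have hb : ∀ y ∈ Metric.ball x r, s y ≤ s x + d ∧ 1 / p x - d ≤ 1 / p y ∧
      1 / γ y ≤ 1 / γ x + d := by
    intro y hy
    obtain ⟨h1, h2, h3⟩ := hball y hy
    rw [abs_le] at h1 h2 h3
    refine ⟨?_, ?_, ?_⟩ <;> linarith
  set v := μ.real (Metric.ball x r) with hv'
  have hvpos : 0 < v := hμ.real_ball_pos x hr
  have hrQ : 0 < r ^ Q x := Real.rpow_pos_of_pos hr _
  set α := v / r ^ Q x with hα
  have hα0 : 0 < α := by positivity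
  have hratio : (μ (Metric.ball x r) / ENNReal.ofReal (r ^ Q x)) ^ ω =
      ENNReal.ofReal (α ^ ω) := by
    rw [← hμ.ofReal_real_ball, ← ENNReal.ofReal_div_of_pos hrQ,
      ENNReal.ofReal_rpow_of_pos hα0]
  have hkey := rpow_le_of_closedBall_rpow_le hμ z (ρ := ρ) (a := s x + d) (a₁ := a₁)
    (g := 1 / γ x + d) (g₁ := 1 / γ₀ + κ / 4) (β := 1 / p x - d) (β₀ := κ / 2)
    (K := 2 * C₀ * K * α ^ ω) hρ0
    (by linarith) (by linarith [hs₁' x]) (by linarith) (by linarith) (by positivity)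
    (by linarith) (by positivity) (by
      intro t' t h0 h1 h2 hw
      have htr : Metric.ball z t ⊆ Metric.ball x r := (Metric.ball_subset_ball h2).trans hz
      have htr' : Metric.closedBall z t' ⊆ Metric.ball x r :=
        (Metric.closedBall_subset_ball h1).trans htr
      have hL : 0 < t - t' := by linarith
      have hvt0 := hμ.real_ball_pos z (h0.trans_lt h1)
      have hwz : μ.real (Metric.closedBall z t') ≤ μ.real (Metric.ball z ρ) :=
        hμ.real_closedBall_le z (h1.trans_le h2)
      have hzv : μ.real (Metric.ball z ρ) ≤ v := measureReal_mono hz (hμ.measure_ball_ne_top x r)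
      have hvt1 : μ.real (Metric.ball z t) ≤ 1 := (hμ.real_ball_mono z h2).trans (hzv.trans hv)
      set T := (t - t') ^ (-(s x + d)) * μ.real (Metric.ball z t) ^ (1 / p x - d) with hT
      have hT0 : 0 < T := by positivity
      have e1 := hbump z t' t h1 (Metric.ball x (σ * r)) T hT0
        (lintegral_rpow_div_le_one hp.1.2.1 Metric.isOpen_ball.measurableSet hL (by linarith)
          (fun y hy => (hb y (htr hy)).1) (fun y hy => (hb y (htr hy)).2.1) hvt0
          hvt1 (hμ.ofReal_real_ball z t).ge)
      have e2 := h x r hr hrσ _ ⟨(continuous_radialBump z t' t).measurable,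
        e1.trans_lt ENNReal.ofReal_lt_top⟩
      have e3 := le_iInf_lebesgueNorm_radialBump_sub (ν := μ.restrict (Metric.ball x r))
        hγ.1.2.1 h1 Metric.isClosed_closedBall.measurableSet
        (F₂ := Metric.ball z' ρ) Metric.isOpen_ball.measurableSet
        Subset.rfl (hdisj.mono_right (Metric.ball_subset_ball h2)) hw hw
        (hwz.trans (hzv.trans hv)) (hwz.trans (hzv.trans hv))
        (G₁ := 1 / γ x + d) (G₂ := 1 / γ x + d) (by linarith) (by linarith)
        (fun y hy => (hb y (htr' hy)).2.2) (fun y hy => (hb y (hz' hy)).2.2)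
        (by rw [Measure.restrict_apply Metric.isClosed_closedBall.measurableSet,
              inter_eq_left.mpr htr', hμ.ofReal_real_closedBall])
        (by rw [Measure.restrict_apply Metric.isOpen_ball.measurableSet, inter_eq_left.mpr hz',
              ← hμ.ofReal_real_ball]
            exact ENNReal.ofReal_le_ofReal (hwz.trans hzz'))
      rw [min_self] at e3
      have e4 := e3.trans (e2.trans (mul_le_mul_right e1 _))
      rw [hratio, ← ENNReal.ofReal_mul hC₀.le, ← ENNReal.ofReal_mul (by positivity),
        ENNReal.ofReal_le_ofReal_iff (by positivity)] at e4
      linarith)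
  have hDpos : 0 < D := by
    have : (2 : ℝ) ^ (-(κ / 2 / a₁)) < 1 :=
      Real.rpow_lt_one_of_one_lt_of_neg one_lt_two (by rw [neg_lt_zero]; positivity)
    have h2 : 0 < 1 - (2 : ℝ) ^ (-(κ / 2 / a₁)) := by linarith
    positivity
  have hkey' : ρ ^ (s x + d) ≤ D * (α ^ ω * v ^ (1 / p x - 1 / γ x - 2 * d)) := by
    refine hkey.trans (le_trans (le_of_eq ?_) (b := D * (α ^ ω *
      μ.real (Metric.ball z ρ) ^ (1 / p x - 1 / γ x - 2 * d))) ?_)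
    · rw [hD, show 1 / p x - d - (1 / γ x + d) = 1 / p x - 1 / γ x - 2 * d by ring]
      ring
    · have : 0 ≤ 1 / p x - 1 / γ x - 2 * d := by linarith
      gcongr
      exact measureReal_mono hz (hμ.measure_ball_ne_top x r)
  clear_value D
  have hlog := Real.log_le_log (by positivity) hkey'
  rw [Real.log_rpow hρ0, Real.log_mul hDpos.ne' (by positivity),
    Real.log_mul (by positivity) (by positivity), Real.log_rpow hα0, Real.log_rpow hvpos] at hlog
  set m := Real.log (1 / v) with hm
  set l := Real.log (1 / r) with hl
  have hm' : Real.log v = -m := by rw [hm, one_div, Real.log_inv, neg_neg]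
  have hl' : Real.log r = -l := by rw [hl, one_div, Real.log_inv, neg_neg]
  have hα' : Real.log α = -(m - Q x * l) := by
    rw [hα, Real.log_div hvpos.ne' hrQ.ne', Real.log_rpow hr, hm', hl']
    ring
  have hρ' : Real.log ρ = -l - c₀ := by
    have h1 := Real.log_inv (lam / 4)
    rw [inv_div] at h1
    rw [hρ, mul_div_right_comm, Real.log_mul (by positivity) hr.ne', hl', hc₀, h1]
    ring
  have hm0 : 0 ≤ m := by
    have := Real.log_nonpos hvpos.le hv
    linarith
  have hl0 : 0 ≤ l := by
    have := Real.log_nonpos hr.le (hr1.trans hr₁1.le)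
    linarith
  have hM'κ : 0 ≤ M' / κ := by positivity
  -- If m ≤ Q l the bound is immediate. Otherwise the factor α^ω contributes W = ω(m - Q l) ≥ 0 on
  -- the favourable side, and it can finally be dropped.
  rcases le_total (m - Q x * l) 0 with hneg | hpos
  · linarith
  rw [hm', hα', hρ'] at hlog
  have hfin := absorb_log_error (W := ω * (m - Q x * l)) (B := 1 / p x - 1 / γ x) (d := d) (m := m)
    (A := M) (S := s x) (S₁ := s₁) (l := l) (κ := κ) (C := C) (d₁ := κ / 4) (by positivity) hκ hB
    hd0 (by linarith) hd1 hm0 hdl hl0 hM0 (hs₁' x) hs₁.le (by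
      have h3 := le_abs_self (Real.log D)
      have h4 : (s x + d) * c₀ ≤ a₁ * c₀ := by
        gcongr
        linarith [hs₁' x]
      rw [hM]
      linarith)
  rw [← hM'] at hfin
  have hBpos : 0 < 1 / p x - 1 / γ x := hκ.trans_le hB
  have hQB : (1 / p x - 1 / γ x) * Q x = s x := by rw [hQ, mul_comm, div_mul_cancel₀ _ hBpos.ne']
  have h5 : κ * (m - Q x * l) ≤ M' := by
    have h6 : κ * (m - Q x * l) ≤ (1 / p x - 1 / γ x) * (m - Q x * l) := by gcongr
    have h7 : 0 ≤ ω * (m - Q x * l) := by positivity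
    have h8 : (1 / p x - 1 / γ x) * (m - Q x * l) = (1 / p x - 1 / γ x) * m - s x * l := by
      rw [← hQB]; ring
    linarith
  have h9 : m - Q x * l ≤ M' / κ := by
    rw [le_div_iff₀ hκ]; linarith
  linarith

end Local

/-! ### Local Moser–Trudinger inequalities -/

/-- The bound on gaps between radii that an exponential estimate yields. -/
theorem gap_le_of_mul_exp_le {C₁ C₂ ω K κ P₁ β y v t w N : ℝ} (hC₁ : 0 < C₁) (hC₂ : 0 < C₂)
    (hω : 0 < ω) (hK : 0 < K) (hκ : 0 < κ) (hβ : κ / 2 ≤ β) (hβ' : β ≤ P₁) (hy : 0 < y) (hv : 0 < v)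
    (ht : 0 < t) (htw : t ≤ 2 * w) (hN : 0 < N) (hNT : N ≤ K * (y⁻¹ * t ^ β))
    (h : w / v * Real.exp ((C₁ * (1 / 2 / N)) ^ ω) ≤ C₂) :
    y ≤ 2 * K / C₁ * (ω * κ / 4)⁻¹ ^ (1 / ω) * (max 1 (2 * C₂)) ^ (P₁ / 2) *
      v ^ (β / 2) * t ^ (β / 2) := by
  have hw : 0 < w := by linarith
  have hβ0 : 0 < β := by linarith
  set x := C₁ * (1 / 2 / N) with hx
  have hx0 : 0 < x := by positivity
  set Y := 2 * C₂ * v / t with hY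
  have hY0 : 0 < Y := by positivity
  have h1 : Real.exp (x ^ ω) ≤ Y := by
    rw [div_mul_eq_mul_div, div_le_iff₀ hv] at h
    rw [hY, le_div_iff₀ ht]
    nlinarith [Real.exp_pos (x ^ ω)]
  -- From log Y ≤ Y^ε/ε with this ε, the root of order ω leaves Y^{β/2}. Half of the power t^β
  -- survives for the iteration, and the other half reappears as v^{β/2}.
  set ε := ω * β / 2 with hε
  have hε0 : 0 < ε := by positivity
  have hεκ : ω * κ / 4 ≤ ε := by rw [hε]; nlinarith
  have h2 : x ^ ω ≤ Y ^ ε / ε := by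
    calc x ^ ω = Real.log (Real.exp (x ^ ω)) := (Real.log_exp _).symm
      _ ≤ Real.log Y := Real.log_le_log (Real.exp_pos _) h1
      _ ≤ _ := Real.log_le_rpow_div hY0.le hε0
  have h3 : x ≤ Y ^ (β / 2) * (ω * κ / 4)⁻¹ ^ (1 / ω) := by
    calc x = (x ^ ω) ^ (1 / ω) := by
          rw [← Real.rpow_mul hx0.le, mul_one_div_cancel hω.ne', Real.rpow_one]
      _ ≤ (Y ^ ε * (ω * κ / 4)⁻¹) ^ (1 / ω) := by
          refine Real.rpow_le_rpow (by positivity) (h2.trans ?_) (by positivity)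
          rw [div_eq_mul_inv]
          gcongr
      _ = _ := by
          rw [Real.mul_rpow (by positivity) (by positivity), ← Real.rpow_mul hY0.le]
          congr 2
          rw [hε]
          field_simp
  have h4 : Y ^ (β / 2) ≤ (max 1 (2 * C₂)) ^ (P₁ / 2) * (v ^ (β / 2) / t ^ (β / 2)) := by
    rw [hY, mul_div_assoc, Real.mul_rpow (by positivity) (by positivity),
      Real.div_rpow hv.le ht.le]
    gcongr ?_ * _
    calc (2 * C₂) ^ (β / 2) ≤ (max 1 (2 * C₂)) ^ (β / 2) := by
          gcongr
          exact le_max_right _ _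
      _ ≤ _ := Real.rpow_le_rpow_of_exponent_le (le_max_left _ _) (by linarith)
  have h5 : y ≤ 2 * K / C₁ * t ^ β * x := by
    have e : 2 * K / C₁ * t ^ β * x = K * t ^ β / N := by rw [hx]; field_simp
    rw [e, le_div_iff₀ hN]
    calc y * N ≤ y * (K * (y⁻¹ * t ^ β)) := by gcongr
      _ = _ := by field_simp
  have htt : t ^ β = t ^ (β / 2) * t ^ (β / 2) := by rw [← Real.rpow_add ht, add_halves]
  calc y ≤ 2 * K / C₁ * t ^ β * x := h5
    _ ≤ 2 * K / C₁ * t ^ β * ((max 1 (2 * C₂)) ^ (P₁ / 2) * (v ^ (β / 2) / t ^ (β / 2)) *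
        (ω * κ / 4)⁻¹ ^ (1 / ω)) := by
      gcongr
      exact h3.trans (by gcongr)
    _ = _ := by
      rw [htt]
      have : t ^ (β / 2) ≠ 0 := by positivity
      field_simp

theorem ofReal_le_expAverage {X : Type*} [MeasurableSpace X] {μ : Measure X} {B F : Set X}
    (hF : MeasurableSet F) (hFB : F ⊆ B) {ω x w v : ℝ}
    (hω : 0 ≤ ω) (hx : 0 ≤ x) (hv : 0 < v) {f : X → ℝ} (hf : ∀ y ∈ F, x ≤ f y)
    (hw : ENNReal.ofReal w ≤ μ F) (hB : μ B = ENNReal.ofReal v) :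
    ENNReal.ofReal (w / v * Real.exp (x ^ ω)) ≤ expAverage μ B ω f := by
  rw [div_mul_eq_mul_div, ENNReal.ofReal_div_of_pos hv, expAverage, hB, mul_comm,
    ENNReal.ofReal_mul (Real.exp_pos _).le]
  gcongr
  calc ENNReal.ofReal (Real.exp (x ^ ω)) * ENNReal.ofReal w
      ≤ ENNReal.ofReal (Real.exp (x ^ ω)) * μ F := by gcongr
    _ = ∫⁻ _ in F, ENNReal.ofReal (Real.exp (x ^ ω)) ∂μ := by simp
    _ ≤ ∫⁻ y in F, ENNReal.ofReal (Real.exp (f y ^ ω)) ∂μ := by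
        refine setLIntegral_mono' hF fun y hy => ?_
        refine ENNReal.ofReal_le_ofReal (Real.exp_le_exp.mpr ?_)
        exact Real.rpow_le_rpow hx (hf y hy) hω
    _ ≤ _ := lintegral_mono_set hFB

section MoserTrudinger

variable {X : Type*} [MetricSpace X] [MeasurableSpace X] [BorelSpace X] {μ : Measure X}
  {p s : X → ℝ} {q : X → ℝ≥0∞}

theorem le_iInf_expAverage_radialBump_sub {B F : Set X} {z : X} {a b : ℝ} (hab : a < b)
    (hF : MeasurableSet F) (hFB : F ⊆ B) (haB : Metric.closedBall z a ⊆ B)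
    (hFb : Disjoint F (Metric.ball z b)) {C₁ ω w v N : ℝ} (hC₁ : 0 < C₁) (hω : 0 ≤ ω) (hv : 0 < v)
    (hN : 0 < N) (hw : ENNReal.ofReal w ≤ μ F) (hwa : ENNReal.ofReal w ≤ μ (Metric.closedBall z a))
    (hB : μ B = ENNReal.ofReal v) :
    ENNReal.ofReal (w / v * Real.exp ((C₁ * (1 / 2 / N)) ^ ω)) ≤
      ⨅ c : ℝ, expAverage μ B ω (fun x => C₁ * (|radialBump z a b x - c| / N)) := by
  refine le_iInf fun c => ?_
  rcases le_total (1 / 2) |c| with hc | hc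
  · refine ofReal_le_expAverage hF hFB hω (by positivity) hv (fun y hy => ?_) hw hB
    rw [radialBump_eq_zero hab (disjoint_left.mp hFb hy), zero_sub, abs_neg]
    gcongr
  · refine ofReal_le_expAverage Metric.isClosed_closedBall.measurableSet haB hω (by positivity) hv
      (fun y hy => ?_) hwa hB
    rw [radialBump_eq_one hab hy]
    rw [abs_le] at hc
    rw [abs_of_nonneg (by linarith : 0 ≤ 1 - c)]
    gcongr
    linarith

theorem lowerAhlforsRegular_of_local_moser [Nontrivial X] (hμ : IsMetricMeasure μ)
    (hX : UniformlyPerfect X) {A : HajlaszScale} {σ : ℝ} (hσ : 1 ≤ σ)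
    (hp : IsBddLogExponent μ p) (hs : IsBddLogExponent μ s)
    (hq : IsExponent μ q) (hsq : SmoothnessAdmissible μ s q)
    {C₁ C₂ ω : ℝ} (hC₁ : 0 < C₁) (hC₂ : 0 < C₂) (hω : 0 < ω)
    (h : ∀ (x₀ : X) (r₀ : ℝ), 0 < r₀ → r₀ ≤ 1 / σ →
      ∀ u : X → ℝ, MemHom A μ s p q (Metric.ball x₀ (σ * r₀)) u →
        0 < homNorm A μ s p q (Metric.ball x₀ (σ * r₀)) u →
        (⨅ c : ℝ, expAverage μ (Metric.ball x₀ r₀) ω (fun x => C₁ * (|u x - c| /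
            (homNorm A μ s p q (Metric.ball x₀ (σ * r₀)) u).toReal))) ≤ ENNReal.ofReal C₂) :
    LowerAhlforsRegular μ (fun x => s x * p x) := by
  obtain ⟨lam, hlam0, hlam1, hperf⟩ := hX
  obtain ⟨K, hK, hbump⟩ := exists_homNorm_radialBump_le_of_admissible hμ A hp hs hq hsq
  obtain ⟨R₀, hR₀, hcompl⟩ := exists_compl_ball_nonempty (X := X)
  obtain ⟨s₀, s₁, hs₀, hs₁, hs₀', hs₁'⟩ := hs.exists_bounds hμ
  obtain ⟨p₀, p₁, hp₀, hp₁, hp₀', hp₁'⟩ := hp.exists_bounds hμ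
  obtain ⟨q₀, hq₀, hq₀'⟩ := hq.exists_real_lower_bound
  set κ := 1 / p₁ with hκdef
  have hκ : 0 < κ := by positivity
  obtain ⟨C, r₁, hC, hr₁, hr₁1, hosc⟩ := exists_uniform_oscillation (d₁ := κ / 4) (by positivity)
    (hs.exists_abs_sub_le hμ) hp.2.exists_abs_sub_le hp.2.exists_abs_sub_le
  have hσ0 : 0 < σ := by linarith
  set a₁ := s₁ + κ / 4 with ha₁
  set D₀ := 2 * K / C₁ * (ω * κ / 4)⁻¹ ^ (1 / ω) * (max 1 (2 * C₂)) ^ (1 / p₀ / 2) with hD₀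
  have hD₀pos : 0 < D₀ := by positivity
  clear_value D₀
  set D := D₀ * ((1 - 2 ^ (-(κ / 4 / a₁)))⁻¹) ^ a₁ with hD
  have hDpos : 0 < D := by
    have : (2 : ℝ) ^ (-(κ / 4 / a₁)) < 1 :=
      Real.rpow_lt_one_of_one_lt_of_neg one_lt_two (by rw [neg_lt_zero]; positivity)
    have h2 : 0 < 1 - (2 : ℝ) ^ (-(κ / 4 / a₁)) := by linarith
    positivity
  clear_value D
  set c₀ := Real.log (4 / lam) with hc₀
  have hc₀0 : 0 < c₀ := Real.log_pos (by rw [lt_div_iff₀ hlam0]; linarith)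
  set M := |Real.log D| + a₁ * c₀ with hM
  have hM0 : 0 ≤ M := by positivity
  set M' := M + C + 4 / κ * (κ / 4 * M + s₁ * C + κ / 4 * C) with hM'
  have hM'0 : 0 ≤ M' := by positivity
  set R := min r₁ (min R₀ (1 / σ)) with hR
  refine lowerAhlforsRegular_of_log_bound hμ (Q₁ := s₁ * p₁) (A := M' * p₁) (r₁ := R) (v₀ := 1)
    (fun x => (mul_pos (hs.1.2.1 x) (hp.1.2.1 x)).le)
    (fun x => mul_le_mul (hs₁' x) (hp₁' x) (hp.1.2.1 x).le hs₁.le) (by positivity)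
    ((min_le_left _ _).trans hr₁1.le) one_pos ?_
  intro x r hr hrR hv
  have hr1 : r ≤ r₁ := hrR.trans (min_le_left _ _)
  have hrR₀ : r ≤ R₀ := hrR.trans ((min_le_right _ _).trans (min_le_left _ _))
  have hrσ : r ≤ 1 / σ := hrR.trans ((min_le_right _ _).trans (min_le_right _ _))
  obtain ⟨d, hd0, hd1, hdl, hball⟩ := hosc x r hr hr1
  obtain ⟨z, z', hz, hz', hdisj, hzz'⟩ := exists_disjoint_balls (μ := μ) hlam1 hperf x hr
    (hcompl x (r / 2) (by linarith))
  set ρ := lam * r / 4 with hρ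
  have hρ0 : 0 < ρ := by positivity
  have hρr : ρ ≤ r := by rw [hρ]; nlinarith
  have hpx := hp.1.2.1 x
  have hsx := hs.1.2.1 x
  have hB : κ ≤ 1 / p x := one_div_le_one_div_of_le hpx (hp₁' x)
  have hB' : 1 / p x ≤ 1 / p₀ := one_div_le_one_div_of_le hp₀ (hp₀' x)
  have hb : ∀ y ∈ Metric.ball x r, s y ≤ s x + d ∧ 1 / p x - d ≤ 1 / p y := by
    intro y hy
    obtain ⟨h1, h2, -⟩ := hball y hy
    rw [abs_le] at h1 h2
    constructor <;> linarith
  set v := μ.real (Metric.ball x r) with hv'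
  have hvpos : 0 < v := hμ.real_ball_pos x hr
  have hzv : μ.real (Metric.ball z ρ) ≤ v := measureReal_mono hz (hμ.measure_ball_ne_top x r)
  have hxσ : Metric.ball x r ⊆ Metric.ball x (σ * r) :=
    Metric.ball_subset_ball (le_mul_of_one_le_left hr.le hσ)
  -- The iteration runs with exponent β/2, the factor v^{β/2} being a constant. Since μ(B(z,ρ)) ≤ v,
  -- the two halves recombine to v^β, with no loss in the final exponent.
  have hkey := radius_rpow_le_of_gap hμ z (ρ := ρ) (a := s x + d) (a₁ := a₁) (b₀ := κ / 4 / a₁)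
    (β := (1 / p x - d) / 2) (K := D₀ * v ^ ((1 / p x - d) / 2)) hρ0
    (by linarith) (by linarith [hs₁' x]) (by positivity)
    (by
      rw [div_mul_eq_mul_div, div_le_iff₀ (by positivity)]
      have h1 : κ / 4 ≤ (1 / p x - d) / 2 := by linarith
      exact mul_le_mul h1 (by linarith [hs₁' x]) (by linarith) (by linarith))
    (by positivity) (by
      intro t' t h0 h1 h2 h3
      have htr : Metric.ball z t ⊆ Metric.ball x r := (Metric.ball_subset_ball h2).trans hz
      have htr' : Metric.closedBall z t' ⊆ Metric.ball x r :=
        (Metric.closedBall_subset_ball h1).trans htr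
      have hL : 0 < t - t' := by linarith
      have hvt0 := hμ.real_ball_pos z (h0.trans_lt h1)
      have hw : 0 < μ.real (Metric.closedBall z t') := by linarith
      have hwz : μ.real (Metric.closedBall z t') ≤ μ.real (Metric.ball z ρ) :=
        hμ.real_closedBall_le z (h1.trans_le h2)
      have hvt1 : μ.real (Metric.ball z t) ≤ 1 := (hμ.real_ball_mono z h2).trans (hzv.trans hv)
      have hdisj' : Disjoint (Metric.ball z' ρ) (Metric.ball z t) :=
        hdisj.mono_right (Metric.ball_subset_ball h2)
      set T := (t - t') ^ (-(s x + d)) * μ.real (Metric.ball z t) ^ (1 / p x - d) with hT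
      have hT0 : 0 < T := by positivity
      have e1 := hbump z t' t h1 (Metric.ball x (σ * r)) T hT0
        (lintegral_rpow_div_le_one hp.1.2.1 Metric.isOpen_ball.measurableSet hL (by linarith)
          (fun y hy => (hb y (htr hy)).1) (fun y hy => (hb y (htr hy)).2) hvt0
          hvt1 (hμ.ofReal_real_ball z t).ge)
      have e0 := homNorm_radialBump_pos (A := A) (s := s) hp.1.1 hp₀ hp₀' hq₀ hq₀'
        Metric.isOpen_ball.measurableSet h1 (hz'.trans hxσ) (htr'.trans hxσ)
        (hμ z' ρ hρ0).1 (ENNReal.toReal_pos_iff.mp hw).1 hdisj'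
      have e2 := h x r hr hrσ _ ⟨(continuous_radialBump z t' t).measurable,
        e1.trans_lt ENNReal.ofReal_lt_top⟩ e0
      set N := (homNorm A μ s p q (Metric.ball x (σ * r)) (radialBump z t' t)).toReal with hN
      have hN0 : 0 < N := ENNReal.toReal_pos e0.ne' (e1.trans_lt ENNReal.ofReal_lt_top).ne
      have hNT : N ≤ K * T := ENNReal.toReal_le_of_le_ofReal (by positivity) e1
      have e3 := (le_iInf_expAverage_radialBump_sub (μ := μ) h1
        (Metric.isOpen_ball (x := z') (ε := ρ)).measurableSet hz' htr' hdisj' hC₁ hω.le hvpos hN0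
        (w := μ.real (Metric.closedBall z t'))
        (by rw [← hμ.ofReal_real_ball]; exact ENNReal.ofReal_le_ofReal (hwz.trans hzz'))
        (hμ.ofReal_real_closedBall z t').le (hμ.ofReal_real_ball x r).symm).trans e2
      rw [ENNReal.ofReal_le_ofReal_iff hC₂.le] at e3
      rw [hT, Real.rpow_neg hL.le] at hNT
      rw [hD₀]
      exact gap_le_of_mul_exp_le hC₁ hC₂ hω hK hκ (by linarith) (by linarith) (by positivity)
        hvpos hvt0 h3 hN0 hNT e3)
  have hkey' : ρ ^ (s x + d) ≤ D * v ^ (1 / p x - d) := by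
    have h1 : μ.real (Metric.ball z ρ) ^ ((1 / p x - d) / 2) ≤ v ^ ((1 / p x - d) / 2) :=
      Real.rpow_le_rpow measureReal_nonneg hzv (by linarith)
    have h2 : v ^ (1 / p x - d) = v ^ ((1 / p x - d) / 2) * v ^ ((1 / p x - d) / 2) := by
      rw [← Real.rpow_add hvpos, add_halves]
    calc _ ≤ _ := hkey
      _ = D * v ^ ((1 / p x - d) / 2) * μ.real (Metric.ball z ρ) ^ ((1 / p x - d) / 2) := by
        rw [hD]; ring
      _ ≤ D * v ^ ((1 / p x - d) / 2) * v ^ ((1 / p x - d) / 2) := by gcongr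
      _ = _ := by rw [h2]; ring
  have hlog := Real.log_le_log (by positivity) hkey'
  rw [Real.log_rpow hρ0, Real.log_mul hDpos.ne' (by positivity), Real.log_rpow hvpos] at hlog
  set m := Real.log (1 / v) with hm
  set l := Real.log (1 / r) with hl
  have hm' : Real.log v = -m := by rw [hm, one_div, Real.log_inv, neg_neg]
  have hl' : Real.log r = -l := by rw [hl, one_div, Real.log_inv, neg_neg]
  have hρ' : Real.log ρ = -l - c₀ := by
    have h1 := Real.log_inv (lam / 4)
    rw [inv_div] at h1
    rw [hρ, mul_div_right_comm, Real.log_mul (by positivity) hr.ne', hl', hc₀, h1]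
    ring
  have hm0 : 0 ≤ m := by
    have := Real.log_nonpos hvpos.le hv
    linarith
  have hl0 : 0 ≤ l := by
    have := Real.log_nonpos hr.le (hr1.trans hr₁1.le)
    linarith
  rw [hm', hρ'] at hlog
  -- Only one error d occurs here, since 1/γ is absent. W = d m pads (1/p - d) m to the form W +
  -- (1/p - 2d) m.
  have hfin := absorb_log_error (W := d * m) (B := 1 / p x) (d := d) (m := m)
    (A := M) (S := s x) (S₁ := s₁) (l := l) (κ := κ) (C := C) (d₁ := κ / 4) (by positivity) hκ hB
    hd0 (by linarith) hd1 hm0 hdl hl0 hM0 (hs₁' x) hs₁.le (by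
      have h3 := le_abs_self (Real.log D)
      have h4 : (s x + d) * c₀ ≤ a₁ * c₀ := by
        gcongr
        linarith [hs₁' x]
      rw [hM]
      linarith)
  rw [← hM'] at hfin
  have h5 : 1 / p x * m ≤ M' + s x * l := by
    have : 0 ≤ d * m := by positivity
    linarith
  rw [one_div_mul_eq_div, div_le_iff₀ hpx] at h5
  have h6 : M' * p x ≤ M' * p₁ := by gcongr; exact hp₁' x
  calc m ≤ (M' + s x * l) * p x := h5
    _ ≤ _ := by linarith

end MoserTrudinger

/-! ### Hölder embeddings -/

section Holder

variable {X : Type*} [MetricSpace X] [MeasurableSpace X] [BorelSpace X] {μ : Measure X}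
  {p s α : X → ℝ} {q : X → ℝ≥0∞}

/-- The bump with a = 0 and b = r is 1 at x and 0 at a point y with r ≤ d(x,y) < r/λ, supplied by
uniform perfectness at radius r/λ. The Hölder quotient at (x, y) is then at least (λ/r)^{α(x)}. -/
theorem exists_rpow_le_of_homEmbedsHolder [Nontrivial X] (hμ : IsMetricMeasure μ)
    (hX : UniformlyPerfect X) {A : HajlaszScale}
    (hp : IsBddLogExponent μ p) (hs : IsBddLogExponent μ s)
    (hq : IsExponent μ q) (hsq : SmoothnessAdmissible μ s q) (hα : ∀ x, 0 < α x)
    (h : HomEmbedsHolder A μ s p q α) :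
    ∃ lam K R : ℝ, 0 < lam ∧ lam < 1 ∧ 0 < K ∧ 0 < R ∧ ∀ (x : X) (r : ℝ), 0 < r → r ≤ R →
      ∀ T : ℝ, 0 < T → ∫⁻ y in Metric.ball x r, ENNReal.ofReal (r ^ (-s y) / T) ^ p y ∂μ ≤ 1 →
        (lam / r) ^ α x ≤ K * T := by
  have := hμ.isOpenPosMeasure
  obtain ⟨lam, hlam0, hlam1, hperf⟩ := hX
  obtain ⟨K, hK, hbump⟩ := exists_homNorm_radialBump_le_of_admissible hμ A hp hs hq hsq
  obtain ⟨R₀, hR₀, hcompl⟩ := exists_compl_ball_nonempty (X := X)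
  obtain ⟨C, hC, h⟩ := h
  refine ⟨lam, C * K, lam * R₀, hlam0, hlam1, by positivity, by positivity, ?_⟩
  intro x r hr hrR T hT hmod
  obtain ⟨y, hy1, hy2⟩ := hperf x (r / lam) (by positivity)
    (hcompl x _ (by rw [div_le_iff₀ hlam0]; linarith))
  rw [mul_div_cancel₀ _ hlam0.ne'] at hy2
  have hxy : x ≠ y := by
    rintro rfl
    exact hy2 (Metric.mem_ball_self hr)
  have hd : 0 < dist x y := dist_pos.mpr hxy
  have h1 := hbump x 0 r hr univ T hT (by simpa using hmod)
  obtain ⟨v, hvc, hvu, hv⟩ := h _ ⟨(continuous_radialBump x 0 r).measurable,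
    h1.trans_lt ENNReal.ofReal_lt_top⟩
  -- Nonempty open sets have positive measure, so two continuous representatives coincide and v may
  -- be evaluated at points.
  have hveq : v = radialBump x 0 r :=
    (Continuous.ae_eq_iff_eq μ hvc (continuous_radialBump x 0 r)).mp hvu
  have h2 : ENNReal.ofReal (|v x - v y| / dist x y ^ α x) ≤ holderSeminorm α v :=
    le_iSup_of_le x (le_iSup_of_le y (le_iSup_of_le hxy le_rfl))
  have h3 := h2.trans (hv.trans (mul_le_mul_right h1 _))
  rw [← ENNReal.ofReal_mul hC.le, ENNReal.ofReal_le_ofReal_iff (by positivity), hveq,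
    radialBump_eq_one hr (Metric.mem_closedBall_self le_rfl), radialBump_eq_zero hr hy2, sub_zero,
    abs_one] at h3
  calc (lam / r) ^ α x ≤ (1 / dist x y) ^ α x := by
        have := hα x
        gcongr ?_ ^ _
        rw [div_le_div_iff₀ hr hd, one_mul]
        rw [Metric.mem_ball', lt_div_iff₀ hlam0] at hy1
        linarith
    _ = 1 / dist x y ^ α x := by rw [Real.div_rpow zero_le_one hd.le, Real.one_rpow]
    _ ≤ _ := by linarith

theorem le_of_homEmbedsHolder [Nontrivial X] (hμ : IsMetricMeasure μ)
    (hX : UniformlyPerfect X) {A : HajlaszScale}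
    (hp : IsBddLogExponent μ p) (hs : IsBddLogExponent μ s)
    (hq : IsExponent μ q) (hsq : SmoothnessAdmissible μ s q) (hα : ∀ x, 0 < α x)
    (h : HomEmbedsHolder A μ s p q α) (x : X) : α x ≤ s x := by
  obtain ⟨lam, K, R, hlam0, hlam1, hK, hR, h⟩ :=
    exists_rpow_le_of_homEmbedsHolder hμ hX hp hs hq hsq hα h
  obtain ⟨p₀, -, hp₀, -, hp₀', -⟩ := hp.exists_bounds hμ
  obtain ⟨C, r₁, hC, hr₁, hr₁1, hosc⟩ := exists_uniform_oscillation one_pos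
    (hs.exists_abs_sub_le hμ) (hs.exists_abs_sub_le hμ) (hs.exists_abs_sub_le hμ)
  by_contra! hlt
  -- For α ≤ s no decay of the measure is needed: bounding it by a constant v ≥ 1 gives (α - s)
  -- log(1/r) = O(1), impossible as r → 0 if α > s.
  set v := max 1 (μ.real (Metric.ball x 1)) with hv
  have hv0 : 0 < v := by positivity
  have hlog : ∀ r : ℝ, 0 < r → r ≤ min R r₁ → (α x - s x) * Real.log (1 / r) ≤
      -(α x * Real.log lam) + Real.log K + 1 / p₀ * Real.log v + C := by
    intro r hr hrR
    have hr1 : r ≤ r₁ := hrR.trans (min_le_right _ _)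
    obtain ⟨d, hd0, -, hdl, hball⟩ := hosc x r hr hr1
    have h1 := h x r hr (hrR.trans (min_le_left _ _)) (r ^ (-(s x + d)) * v ^ (1 / p₀))
      (by positivity) (lintegral_rpow_div_le_one_of_one_le hp.1.2.1
        Metric.isOpen_ball.measurableSet hr (hr1.trans hr₁1.le)
        (fun y hy => by
          have := (abs_le.mp (hball y hy).1).1
          linarith)
        (fun y _ => one_div_le_one_div_of_le hp₀ (hp₀' y)) (le_max_left _ _) (by
          rw [← hμ.ofReal_real_ball]
          exact ENNReal.ofReal_le_ofReal ((hμ.real_ball_mono x (hr1.trans hr₁1.le)).trans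
            (le_max_right _ _))))
    have h2 := Real.log_le_log (by positivity) h1
    rw [Real.log_rpow (by positivity), Real.log_div hlam0.ne' hr.ne',
      Real.log_mul hK.ne' (by positivity), Real.log_mul (by positivity) (by positivity),
      Real.log_rpow hr, Real.log_rpow hv0] at h2
    rw [one_div, Real.log_inv] at hdl ⊢
    linarith
  set Z := -(α x * Real.log lam) + Real.log K + 1 / p₀ * Real.log v + C with hZ
  have hgap : 0 < α x - s x := by linarith
  set L := max ((|Z| + 1) / (α x - s x)) (Real.log (1 / min R r₁)) with hL
  have hmin : 0 < min R r₁ := lt_min hR hr₁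
  have h3 := hlog (Real.exp (-L)) (Real.exp_pos _) (by
    rw [← Real.le_log_iff_exp_le hmin]
    have h4 : Real.log (1 / min R r₁) ≤ L := le_max_right _ _
    rw [one_div, Real.log_inv] at h4
    linarith)
  rw [one_div, Real.log_inv, Real.log_exp, neg_neg] at h3
  have h4 : (|Z| + 1) / (α x - s x) ≤ L := le_max_left _ _
  rw [div_le_iff₀ hgap] at h4
  linarith [le_abs_self Z]

theorem lowerAhlforsRegular_of_homEmbedsHolder [Nontrivial X] (hμ : IsMetricMeasure μ)
    (hX : UniformlyPerfect X) {A : HajlaszScale}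
    (hp : IsBddLogExponent μ p) (hs : IsBddLogExponent μ s)
    (hq : IsExponent μ q) (hsq : SmoothnessAdmissible μ s q) (hα : IsBddLogExponent μ α)
    (h : HomEmbedsHolder A μ s p q α) :
    LowerAhlforsRegular μ (fun x => p x * (s x - α x)) := by
  have hαs := le_of_homEmbedsHolder hμ hX hp hs hq hsq hα.1.2.1 h
  obtain ⟨lam, K, R, hlam0, hlam1, hK, hR, h⟩ :=
    exists_rpow_le_of_homEmbedsHolder hμ hX hp hs hq hsq hα.1.2.1 h
  obtain ⟨s₀, s₁, hs₀, hs₁, hs₀', hs₁'⟩ := hs.exists_bounds hμ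
  obtain ⟨p₀, p₁, hp₀, hp₁, hp₀', hp₁'⟩ := hp.exists_bounds hμ
  obtain ⟨-, α₁, -, hα₁, -, hα₁'⟩ := hα.exists_bounds hμ
  set κ := 1 / p₁ with hκdef
  have hκ : 0 < κ := by positivity
  obtain ⟨C, r₁, hC, hr₁, hr₁1, hosc⟩ := exists_uniform_oscillation (d₁ := κ / 4) (by positivity)
    (hs.exists_abs_sub_le hμ) hp.2.exists_abs_sub_le hp.2.exists_abs_sub_le
  set c₀ := -Real.log lam with hc₀
  have hc₀0 : 0 < c₀ := by
    have := Real.log_neg hlam0 hlam1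
    linarith
  set M := |Real.log K| + α₁ * c₀ with hM
  have hM0 : 0 ≤ M := by positivity
  set M' := M + C + 4 / κ * (κ / 4 * M + s₁ * C + κ / 4 * C) with hM'
  have hM'0 : 0 ≤ M' := by positivity
  refine lowerAhlforsRegular_of_log_bound hμ (Q₁ := p₁ * s₁) (A := M' * p₁) (r₁ := min R r₁)
    (v₀ := 1) (fun x => mul_nonneg (hp.1.2.1 x).le (sub_nonneg.mpr (hαs x)))
    (fun x => mul_le_mul (hp₁' x) (by linarith [hs₁' x, hα.1.2.1 x])
      (sub_nonneg.mpr (hαs x)) hp₁.le) (lt_min hR hr₁)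
    ((min_le_right _ _).trans hr₁1.le) one_pos ?_
  intro x r hr hrR hv
  have hr1 : r ≤ r₁ := hrR.trans (min_le_right _ _)
  obtain ⟨d, hd0, hd1, hdl, hball⟩ := hosc x r hr hr1
  have hpx := hp.1.2.1 x
  have hαx := hα.1.2.1 x
  have hB : κ ≤ 1 / p x := one_div_le_one_div_of_le hpx (hp₁' x)
  have hb : ∀ y ∈ Metric.ball x r, s y ≤ s x + d ∧ 1 / p x - d ≤ 1 / p y := by
    intro y hy
    obtain ⟨h1, h2, -⟩ := hball y hy
    rw [abs_le] at h1 h2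
    constructor <;> linarith
  set v := μ.real (Metric.ball x r) with hv'
  have hvpos : 0 < v := hμ.real_ball_pos x hr
  have hkey := h x r hr (hrR.trans (min_le_left _ _)) (r ^ (-(s x + d)) * v ^ (1 / p x - d))
    (by positivity) (lintegral_rpow_div_le_one hp.1.2.1 Metric.isOpen_ball.measurableSet hr
      (hr1.trans hr₁1.le) (fun y hy => (hb y hy).1) (fun y hy => (hb y hy).2) hvpos hv
      (hμ.ofReal_real_ball x r).ge)
  have hlog := Real.log_le_log (by positivity) hkey
  rw [Real.log_rpow (by positivity), Real.log_div hlam0.ne' hr.ne',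
    Real.log_mul hK.ne' (by positivity), Real.log_mul (by positivity) (by positivity),
    Real.log_rpow hr, Real.log_rpow hvpos] at hlog
  set m := Real.log (1 / v) with hm
  set l := Real.log (1 / r) with hl
  have hm' : Real.log v = -m := by rw [hm, one_div, Real.log_inv, neg_neg]
  have hl' : Real.log r = -l := by rw [hl, one_div, Real.log_inv, neg_neg]
  have hm0 : 0 ≤ m := by
    have := Real.log_nonpos hvpos.le hv
    linarith
  have hl0 : 0 ≤ l := by
    have := Real.log_nonpos hr.le (hr1.trans hr₁1.le)
    linarith
  rw [hm', hl'] at hlog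
  have hfin := absorb_log_error (W := d * m) (B := 1 / p x) (d := d) (m := m)
    (A := M) (S := s x - α x) (S₁ := s₁) (l := l) (κ := κ) (C := C) (d₁ := κ / 4)
    (by positivity) hκ hB hd0 (by linarith) hd1 hm0 hdl hl0 hM0 (by linarith [hs₁' x]) hs₁.le (by
      have h3 := le_abs_self (Real.log K)
      have h4 : α x * c₀ ≤ α₁ * c₀ := by
        gcongr
        exact hα₁' x
      rw [hM]
      rw [hc₀] at h4 ⊢
      linarith)
  rw [← hM'] at hfin
  have h5 : 1 / p x * m ≤ M' + (s x - α x) * l := by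
    have : 0 ≤ d * m := by positivity
    linarith
  rw [one_div_mul_eq_div, div_le_iff₀ hpx] at h5
  have h6 : M' * p x ≤ M' * p₁ := by gcongr; exact hp₁' x
  calc m ≤ (M' + (s x - α x) * l) * p x := h5
    _ ≤ _ := by linarith

/-- With exponent 0 all small balls about x have measure at least b, and continuity from above
passes this to the point itself. -/
theorem measure_singleton_pos_of_lowerAhlforsRegular (hμ : IsMetricMeasure μ) {Q : X → ℝ}
    (h : LowerAhlforsRegular μ Q) {x : X} (hx : Q x = 0) : 0 < μ {x} := by
  obtain ⟨b, hb, h⟩ := h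
  have h1 : b ≤ μ.real (Metric.closedBall x 0) := by
    refine le_real_closedBall_of_forall_lt hμ x one_pos fun r hr hr1 => ?_
    have h2 := h x r hr hr1
    rw [hx, Real.rpow_zero, mul_one, ← hμ.ofReal_real_ball,
      ENNReal.ofReal_le_ofReal_iff measureReal_nonneg] at h2
    exact h2
  rw [Metric.closedBall_zero] at h1
  exact (ENNReal.toReal_pos_iff.mp (hb.trans_le h1)).1

end Holder

theorem mainTheorem3 {X : Type*} [MetricSpace X] [MeasurableSpace X] [BorelSpace X]
    (μ : Measure X) (hμ : IsMetricMeasure μ) (A : HajlaszScale) (σ : ℝ) (hσ : 1 ≤ σ)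
    (p s : X → ℝ) (q : X → ℝ≥0∞) (hp : IsBddLogExponent μ p) (hs : IsBddLogExponent μ s)
    (hq : IsExponent μ q) (hsq : SmoothnessAdmissible μ s q) :
    -- (i) global Sobolev embedding
    (∀ γ : X → ℝ, IsBddLogExponent μ γ → ExponentGG μ γ p →
      (HomEmbedsLebesgue A μ s p q γ ∨ HomEmbedsLebesgueModConst A μ s p q γ ∨
        InhomEmbedsLebesgue A μ s p q γ) →
      LowerAhlforsRegular μ (fun x => γ x * s x * p x / (γ x - p x))) ∧
    (UniformlyPerfect X →
      -- (ii) local Sobolev inequalities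
      (∀ γ : X → ℝ, IsBddLogExponent μ γ → ExponentGG μ γ p →
        ∀ Q : X → ℝ, (∀ x, Q x = s x * p x * γ x / (γ x - p x)) →
        (∃ C ω : ℝ, 0 < C ∧ 0 < ω ∧ ∀ (x₀ : X) (r₀ : ℝ), 0 < r₀ → r₀ ≤ 1 / σ →
          ∀ u : X → ℝ, MemHom A μ s p q (Metric.ball x₀ (σ * r₀)) u →
            (⨅ c : ℝ, lebesgueNorm (μ.restrict (Metric.ball x₀ r₀)) γ
                (fun x => ENNReal.ofReal |u x - c|)) ≤
              ENNReal.ofReal C *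
                (μ (Metric.ball x₀ r₀) / ENNReal.ofReal (r₀ ^ Q x₀)) ^ ω *
                homNorm A μ s p q (Metric.ball x₀ (σ * r₀)) u) →
        LowerAhlforsRegular μ Q) ∧
      -- (iii) local Moser-Trudinger inequalities
      ((∃ C₁ C₂ ω : ℝ, 0 < C₁ ∧ 0 < C₂ ∧ 0 < ω ∧
          ∀ (x₀ : X) (r₀ : ℝ), 0 < r₀ → r₀ ≤ 1 / σ →
          ∀ u : X → ℝ, MemHom A μ s p q (Metric.ball x₀ (σ * r₀)) u →
            0 < homNorm A μ s p q (Metric.ball x₀ (σ * r₀)) u →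
            (⨅ c : ℝ, expAverage μ (Metric.ball x₀ r₀) ω (fun x => C₁ * (|u x - c| /
                (homNorm A μ s p q (Metric.ball x₀ (σ * r₀)) u).toReal))) ≤
              ENNReal.ofReal C₂) →
        LowerAhlforsRegular μ (fun x => s x * p x)) ∧
      -- (iv) global Hölder embedding
      (Nontrivial X → ∀ α : X → ℝ, IsBddLogExponent μ α → HomEmbedsHolder A μ s p q α →
        (∀ x, α x ≤ s x) ∧
        LowerAhlforsRegular μ (fun x => p x * (s x - α x)) ∧
        ∀ x₀ : X, s x₀ = α x₀ → 0 < μ {x₀})) := by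
  -- Spaces with at most one point are separated because the local arguments need two points. There
  -- r^Q ≤ 1 suffices for regularity, and (iv) is void.
  rcases subsingleton_or_nontrivial X with hsub | hnt
  · refine ⟨fun γ hγ hγp _ => lowerAhlforsRegular_of_subsingleton hμ fun x => ?_, fun _ =>
      ⟨fun γ hγ hγp Q hQ _ => lowerAhlforsRegular_of_subsingleton hμ fun x => ?_,
        fun _ => lowerAhlforsRegular_of_subsingleton hμ fun x =>
          (mul_pos (hs.1.2.1 x) (hp.1.2.1 x)).le, fun hnt => ?_⟩⟩
    · obtain ⟨ε, hε, hgg⟩ := hγp.exists_forall_le hμ hp hγ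
      have h1 := hgg x
      have h2 := hs.1.2.1 x
      have h3 := hp.1.2.1 x
      have h4 := hγ.1.2.1 x
      exact div_nonneg (by positivity) (by linarith)
    · obtain ⟨ε, hε, hgg⟩ := hγp.exists_forall_le hμ hp hγ
      have h1 := hgg x
      have h2 := hs.1.2.1 x
      have h3 := hp.1.2.1 x
      have h4 := hγ.1.2.1 x
      rw [hQ]
      exact div_nonneg (by positivity) (by linarith)
    · exact absurd hsub (not_subsingleton X)
  refine ⟨fun γ hγ hγp h => ?_, fun hX => ⟨fun γ hγ hγp Q hQ h => ?_, fun h => ?_,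
    fun _ α hα h => ?_⟩⟩
  · refine lowerAhlforsRegular_of_bumpEstimate hμ hp hs hγ hγp ?_
    rcases h with h | h | h
    · exact bumpEstimate_of_homEmbedsLebesgue hμ hp hs hq hsq hγ h
    · exact bumpEstimate_of_homEmbedsLebesgueModConst hμ hp hs hq hsq hγ h
    · exact bumpEstimate_of_inhomEmbedsLebesgue hμ hp hs hq hsq hγ h
  · obtain ⟨C, ω, hC, hω, h⟩ := h
    obtain ⟨κ, hκ, hgap⟩ := exists_gap_of_exponentGG hμ hp hγ hγp
    refine lowerAhlforsRegular_of_local_sobolev hμ hX hσ hp hs hq hsq hγ hγp (fun x => ?_) hC hω h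
    rw [hQ, ← sobolev_exponent_eq (hp.1.2.1 x) (hγ.1.2.1 x) (hκ.trans_le (hgap x))]
    ring
  · obtain ⟨C₁, C₂, ω, hC₁, hC₂, hω, h⟩ := h
    exact lowerAhlforsRegular_of_local_moser hμ hX hσ hp hs hq hsq hC₁ hC₂ hω h
  · have hreg := lowerAhlforsRegular_of_homEmbedsHolder hμ hX hp hs hq hsq hα h
    refine ⟨le_of_homEmbedsHolder hμ hX hp hs hq hsq hα.1.2.1 h, hreg, fun x₀ hx₀ => ?_⟩
    exact measure_singleton_pos_of_lowerAhlforsRegular hμ hreg (by rw [hx₀, sub_self, mul_zero])
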